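/- Let $Q$ be a simple artinian ring and let $R \subseteq Q$ be an order in $Q$: every non-zero-divisor of $R$ is invertible in $Q$, and every element of $Q$ has the form $ac^{-1}$ and the form $d^{-1}b$ with $a,b,c,d\in R$ and $c,d$ non-zero-divisors of $R$. If $R$ is a bounded Krull order in the sense of Chamarie or in the sense of Marubayashi, then $R$ is a BF-ring. Here the following definitions are used. **BF-ring.** Let $R^\bullet$ be the monoid of (two-sided) non-zero-divisors of $R$. An atom of $R^\bullet$ is a nonunit $u$ such that $u=ab$ with $a,b\in R^\bullet$ implies that $a$ or $b$ is a unit. The ring $R$ is a BF-ring if every nonunit of $R^\bullet$ is a product of atoms and if, for every nonunit $a\in R^\bullet$, the set of all $k$ such that $a=u_1\cdots u_k$ with atoms $u_1,\dots,u_k$ of $R^\bullet$ is finite. **Bounded.** The ring $R$ is bounded if every essential right ideal and every essential left ideal of $R$ contains a nonzero two-sided ideal. **Chamarie.** Orders $R,S$ in $Q$ are equivalent if $aRb\subseteq S$ and $cSd\subseteq R$ for some $a,b,c,d\in Q^\times$; a maximal order is one that is maximal with respect to inclusion in its equivalence class. For a right ideal $F$ of $R$ and $r \in R$ let $r^{-1}F=\{x\in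 R : rx\in F\}$. The right ideal $F$ is $\tau$-dense if $\{q\in Q : q\,(r^{-1}F)\subseteq R\}=R$ for all $r\in R$. A right ideal $I$ is $\tau$-closed if $r\in R$ and $rF\subseteq I$ for some $\tau$-dense $F$ imply $r\in I$. The left-sided notions are symmetric. $R$ is a Krull order in the sense of Chamarie if it is a maximal order and satisfies the ascending chain condition on $\tau$-closed right ideals and on $\tau$-closed left ideals. It is a bounded Krull order in the sense of Chamarie if, in addition, $R$ is bounded. **Marubayashi.** A ring $T$ with $R\subseteq T\subseteq Q$ is an essential overring of $R$ if there are a right Gabriel topology $\mathcal F$ and a left Gabriel topology $\mathcal G$ on $R$ such that $T=\{q\in Q: qI\subseteq R \text{ for some } I\in\mathcal F\}=\{q\in Q: Jq\subseteq R \text{ for some } J\in\mathcal G\}$ and $IT=T=TI$ for all $I\in\mathcal F$, and $TJ=T=JT$ for all $J\in\mathcal G$. $R$ is a Krull order in the sense of Marubayashi if there are families $(R_i)_{i\in I}$ and $(S_j)_{j\in J}$ of essential overrings of $R$, with $J$ finite, such that (K1) $R=\bigcap_i R_i\cap\bigcap_j S_j$ (an empty intersection being $Q$); (K2) each $R_i$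 is a (left and right) noetherian local Asano order, that is, $R_i$ modulo its Jacobson radical is simple artinian and every nonzero two-sided ideal of $R_i$ is invertible in $Q$, and each $S_j$ is a (left and right) noetherian simple ring; (K3) for every non-zero-divisor $c$ of $R$, one has $cR_i\neq R_i$ for only finitely many $i$ and $R_ic\ne R_i$ for only finitely many $i$. It is a bounded Krull order in the sense of Marubayashi if, in addition, $R$ is bounded or one can take $J=\emptyset$. -/

import Mathlib

open scoped Pointwise nonZeroDivisors

namespace BoundedKrull

/-! ### Factorizations -/

/-- The set of lengths of factorizations of `a` into atoms; by convention it is `{0}` for units. -/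
def lengthSet {H : Type*} [Monoid H] (a : H) : Set ℕ :=
  {k | (IsUnit a ∧ k = 0) ∨
    (¬ IsUnit a ∧ ∃ l : List H, (∀ u ∈ l, Irreducible u) ∧ l.prod = a ∧ l.length = k)}

/-- Every nonunit is a finite product of atoms. -/
def IsAtomicMonoid (H : Type*) [Monoid H] : Prop :=
  ∀ a : H, ¬ IsUnit a → ∃ l : List H, (∀ u ∈ l, Irreducible u) ∧ l.prod = a

/-- A monoid with bounded factorizations. -/
def IsBFMonoid (H : Type*) [Monoid H] : Prop :=
  IsAtomicMonoid H ∧ ∀ a : H, (lengthSet a).Finite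

/-- A (possibly noncommutative) ring is a BF-ring if its monoid of (two-sided) non-zero-divisors
is a BF-monoid. -/
def IsBFRing (R : Type*) [Ring R] : Prop :=
  IsBFMonoid (nonZeroDivisors R)

/-! ### One-sided ideals, essential ideals, bounded rings -/

/-- Right ideals of a ring; left ideals are Mathlib's `Ideal R`. -/
abbrev RightIdeal (R : Type*) [Ring R] : Type _ := Submodule Rᵐᵒᵖ R

/-- A submodule meeting every nonzero submodule nontrivially. -/
def IsEssentialSubmodule {A M : Type*} [Ring A] [AddCommGroup M] [Module A M]
    (I : Submodule A M) : Prop :=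
  ∀ J : Submodule A M, I ⊓ J = ⊥ → J = ⊥

/-- A ring is bounded if every essential right ideal and every essential left ideal contains a
nonzero two-sided ideal. -/
def IsBoundedRing (R : Type*) [Ring R] : Prop :=
  (∀ I : RightIdeal R, IsEssentialSubmodule I →
    ∃ A : TwoSidedIdeal R, A ≠ ⊥ ∧ ∀ x ∈ A, x ∈ I) ∧
  (∀ I : Ideal R, IsEssentialSubmodule I →
    ∃ A : TwoSidedIdeal R, A ≠ ⊥ ∧ ∀ x ∈ A, x ∈ I)

/-- The right ideal `r⁻¹I = {x | r x ∈ I}`. -/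
def RightIdeal.residual {R : Type*} [Ring R] (I : RightIdeal R) (r : R) : RightIdeal R where
  carrier := {x | r * x ∈ I}
  add_mem' {x y} hx hy := by
    simp only [Set.mem_ofPred_eq] at *
    rw [mul_add]; exact I.add_mem hx hy
  zero_mem' := by simp
  smul_mem' c x hx := by
    simp only [Set.mem_ofPred_eq, MulOpposite.smul_eq_mul_unop] at *
    rw [← mul_assoc]; exact I.smul_mem c hx

/-- The left ideal `I r⁻¹ = {x | x r ∈ I}`. -/
def leftResidual {R : Type*} [Ring R] (I : Ideal R) (r : R) : Ideal R where
  carrier := {x | x * r ∈ I}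
  add_mem' {x y} hx hy := by
    simp only [Set.mem_ofPred_eq] at *
    rw [add_mul]; exact I.add_mem hx hy
  zero_mem' := by simp
  smul_mem' c x hx := by
    simp only [Set.mem_ofPred_eq, smul_eq_mul] at *
    rw [mul_assoc]; exact I.mul_mem_left c hx

section Orders

variable {Q : Type*} [Ring Q]

/-! ### Orders in a quotient ring -/

/-- `R` is a (two-sided) order in `Q`, that is, `Q` is the classical right and left quotient ring
of `R`. -/
structure IsOrder (R : Subring Q) : Prop where
  isUnit_of_regular : ∀ c ∈ nonZeroDivisors R, IsUnit (c : Q)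
  right_fraction : ∀ q : Q, ∃ a : R, ∃ c ∈ nonZeroDivisors R, q * (c : Q) = a
  left_fraction : ∀ q : Q, ∃ a : R, ∃ c ∈ nonZeroDivisors R, (c : Q) * q = a

/-- Equivalence of orders: `a R b ⊆ S` and `c S d ⊆ R` for some units `a, b, c, d` of `Q`. -/
def EquivalentOrders (R S : Subring Q) : Prop :=
  (∃ a b : Qˣ, ∀ x ∈ R, (a : Q) * x * b ∈ S) ∧ (∃ c d : Qˣ, ∀ x ∈ S, (c : Q) * x * d ∈ R)

/-- An order that is maximal (for inclusion) in its equivalence class. -/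
def IsMaximalOrder (R : Subring Q) : Prop :=
  IsOrder R ∧ ∀ S : Subring Q, IsOrder S → EquivalentOrders R S → R ≤ S → S = R

/-! ### Krull orders in the sense of Chamarie -/

/-- `F` is dense for the torsion theory `τ` on right `R`-modules cogenerated by the injective hull
of `Q / R`: for all `r ∈ R`, one has `{q ∈ Q | q (r⁻¹F) ⊆ R} = R`. -/
def IsTauDenseRight (R : Subring Q) (F : RightIdeal R) : Prop :=
  ∀ r : R, {q : Q | ∀ x ∈ F.residual r, q * (x : Q) ∈ R} = (R : Set Q)

/-- Left-sided version of `IsTauDenseRight`. -/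
def IsTauDenseLeft (R : Subring Q) (F : Ideal R) : Prop :=
  ∀ r : R, {q : Q | ∀ x ∈ leftResidual F r, (x : Q) * q ∈ R} = (R : Set Q)

/-- A right ideal `I` is `τ`-closed if `R / I` is `τ`-torsion-free: if `r F ⊆ I` with `F` dense,
then `r ∈ I`. -/
def IsTauClosedRight (R : Subring Q) (I : RightIdeal R) : Prop :=
  ∀ r : R, IsTauDenseRight R (I.residual r) → r ∈ I

/-- Left-sided version of `IsTauClosedRight`. -/
def IsTauClosedLeft (R : Subring Q) (I : Ideal R) : Prop :=
  ∀ r : R, IsTauDenseLeft R (leftResidual I r) → r ∈ I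

/-- A Krull order in the sense of Chamarie: a maximal order with the ascending chain condition on
`τ`-closed right ideals and on `τ`-closed left ideals. -/
structure IsChamarieKrullOrder (R : Subring Q) : Prop where
  isMaximalOrder : IsMaximalOrder R
  acc_right : WellFoundedGT {I : RightIdeal R // IsTauClosedRight R I}
  acc_left : WellFoundedGT {I : Ideal R // IsTauClosedLeft R I}

/-! ### Krull orders in the sense of Marubayashi -/

/-- The product `X Y` of two subsets: all finite sums of elements `± x y`. -/
def addProd (X Y : Set Q) : AddSubgroup Q := AddSubgroup.closure (X * Y)

/-- The underlying set in `Q` of a subset of `R`. -/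
def inQ (R : Subring Q) (X : Set R) : Set Q := Subtype.val '' X

/-- A right Gabriel topology (right additive topology) on a ring. -/
structure IsRightGabrielTopology {R : Type*} [Ring R] (F : Set (RightIdeal R)) : Prop where
  top_mem : ⊤ ∈ F
  mono : ∀ I ∈ F, ∀ J : RightIdeal R, I ≤ J → J ∈ F
  inf_mem : ∀ I ∈ F, ∀ J ∈ F, I ⊓ J ∈ F
  residual_mem : ∀ I ∈ F, ∀ r : R, I.residual r ∈ F
  mem_of_residual : ∀ J ∈ F, ∀ I : RightIdeal R, (∀ r ∈ J, I.residual r ∈ F) → I ∈ F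

/-- A left Gabriel topology (left additive topology) on a ring. -/
structure IsLeftGabrielTopology {R : Type*} [Ring R] (F : Set (Ideal R)) : Prop where
  top_mem : ⊤ ∈ F
  mono : ∀ I ∈ F, ∀ J : Ideal R, I ≤ J → J ∈ F
  inf_mem : ∀ I ∈ F, ∀ J ∈ F, I ⊓ J ∈ F
  residual_mem : ∀ I ∈ F, ∀ r : R, leftResidual I r ∈ F
  mem_of_residual : ∀ J ∈ F, ∀ I : Ideal R, (∀ r ∈ J, leftResidual I r ∈ F) → I ∈ F

/-- `T` is the localization of `R` at the perfect right Gabriel topology `F`: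
`T = {q ∈ Q | q I ⊆ R for some I ∈ F}` and `I T = T` for all `I ∈ F`. (The last condition, which
characterizes perfect topologies, makes every `I ∈ F` essential, so that the localization at `F`
is computed inside `Q`.) -/
structure IsPerfectRightLocalization (R T : Subring Q) (F : Set (RightIdeal R)) : Prop where
  isGabriel : IsRightGabrielTopology F
  mem_iff : ∀ q : Q, q ∈ T ↔ ∃ I ∈ F, ∀ x ∈ I, q * (x : Q) ∈ R
  perfect : ∀ I ∈ F, (addProd (inQ R (I : Set R)) (T : Set Q) : Set Q) = T

/-- Left-sided version of `IsPerfectRightLocalization`. -/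
structure IsPerfectLeftLocalization (R T : Subring Q) (F : Set (Ideal R)) : Prop where
  isGabriel : IsLeftGabrielTopology F
  mem_iff : ∀ q : Q, q ∈ T ↔ ∃ I ∈ F, ∀ x ∈ I, (x : Q) * q ∈ R
  perfect : ∀ I ∈ F, (addProd (T : Set Q) (inQ R (I : Set R)) : Set Q) = T

/-- `T` is an essential overring of `R`: it is the localization of `R` at a perfect right Gabriel
topology `F` and at a perfect left Gabriel topology `G`, and moreover `T I = T` for `I ∈ F` and
`J T = T` for `J ∈ G`. -/
def IsEssentialOverring (R T : Subring Q) : Prop :=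
  R ≤ T ∧ ∃ (F : Set (RightIdeal R)) (G : Set (Ideal R)),
    IsPerfectRightLocalization R T F ∧ IsPerfectLeftLocalization R T G ∧
    (∀ I ∈ F, (addProd (T : Set Q) (inQ R (I : Set R)) : Set Q) = T) ∧
    (∀ J ∈ G, (addProd (inQ R (J : Set R)) (T : Set Q) : Set Q) = T)

/-- A left and right noetherian ring. -/
def IsTwoSidedNoetherian (R : Type*) [Ring R] : Prop :=
  IsNoetherian R R ∧ IsNoetherian Rᵐᵒᵖ R

/-- A ring is local if its factor ring modulo the Jacobson radical is simple artinian. -/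
def IsLocalSimpleArtinian (R : Type*) [Ring R] : Prop :=
  IsSimpleRing (R ⧸ Ring.jacobson R) ∧ IsArtinianRing (R ⧸ Ring.jacobson R)

/-- An Asano order: an order whose nonzero two-sided ideals are all invertible. -/
def IsAsanoOrder (T : Subring Q) : Prop :=
  IsOrder T ∧ ∀ A : TwoSidedIdeal T, A ≠ ⊥ → ∃ X : AddSubgroup Q,
    (addProd (X : Set Q) (inQ T (A : Set T)) : Set Q) = T ∧
    (addProd (inQ T (A : Set T)) (X : Set Q) : Set Q) = T

/-- The sets `𝓡` and `𝓢` of overrings exhibit the order `R` as a Krull order in the sense of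
Marubayashi. -/
structure IsMarubayashiFamily (R : Subring Q) (𝓡 𝓢 : Set (Subring Q)) : Prop where
  isOrder : IsOrder R
  essential : ∀ T ∈ 𝓡 ∪ 𝓢, IsEssentialOverring R T
  eq_sInf : R = sInf (𝓡 ∪ 𝓢)
  noetherian_local_asano : ∀ T ∈ 𝓡,
    IsTwoSidedNoetherian T ∧ IsLocalSimpleArtinian T ∧ IsAsanoOrder T
  noetherian_simple : ∀ T ∈ 𝓢, IsTwoSidedNoetherian T ∧ IsSimpleRing T
  finite_simple : 𝓢.Finite
  /-- `c T ≠ T` for only finitely many `T ∈ 𝓡`. -/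
  finite_right : ∀ c ∈ nonZeroDivisors R,
    {T ∈ 𝓡 | (addProd {(c : Q)} (T : Set Q) : Set Q) ≠ T}.Finite
  /-- `T c ≠ T` for only finitely many `T ∈ 𝓡`. -/
  finite_left : ∀ c ∈ nonZeroDivisors R,
    {T ∈ 𝓡 | (addProd (T : Set Q) {(c : Q)} : Set Q) ≠ T}.Finite

/-- A bounded Krull order in the sense of Chamarie. -/
def IsBoundedKrullChamarie (R : Subring Q) : Prop :=
  IsChamarieKrullOrder R ∧ IsBoundedRing R

/-- A bounded Krull order in the sense of Marubayashi. Boundedness is allowed in both of its usual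
readings: `R` is a bounded ring, or no simple rings are needed in the intersection. -/
def IsBoundedKrullMarubayashi (R : Subring Q) : Prop :=
  ∃ 𝓡 𝓢 : Set (Subring Q), IsMarubayashiFamily R 𝓡 𝓢 ∧ (IsBoundedRing R ∨ 𝓢 = ∅)

end Orders

end BoundedKrull

/-! Both cases attach to each right divisor `c` of a fixed regular `a` a natural number that
strictly grows when `c` is replaced by `u * c` with `u` a nonunit; `isBFMonoid_of_potential` turns
this into bounded factorization lengths.

Marubayashi: the potential is the sum of the lengths of `T / Tc` over the finitely many local
overrings `T` with `Ta ≠ T`. These lengths are finite because `T / Ta` is artinian over a noetherian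
local Asano order (`isArtinian_quotient_of_local_asano`). If the sum does not grow, then `u` is
invertible in each of these `T`. It is also invertible in the remaining local overrings, where `a`
already is, and in the simple ones by boundedness (`exists_left_inv_of_simple_essential`). Hence its
inverse lies in the intersection `R`.

Chamarie: boundedness gives a nonzero two-sided ideal inside `Ra`, and its divisorial closure `D`
still lies in `Ra`. Every `Rc` in question is `τ`-closed and contains `D`, so it suffices to bound
chains of `τ`-closed left ideals between `D` and `R` (`IsMaximalOrder.hasFiniteRank_toIdeal_top`).
By noetherian induction, `D` is enlarged to a divisorial `D'` with `P D' ⊆ D` for a maximal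
divisorial ideal `P`. Since `R / P` is nonsingular, left ideals essential over `P` are `τ`-dense;
this makes the interval from `D` to `D'` behave like a semisimple module of finite length
(`hasFiniteRank_of_mul_le`). Ranks of successive intervals are added by the modular law. -/

namespace BoundedKrull

/-! ### Factorization lengths and potentials in monoids -/

section Factorizations

variable {H : Type*} [Monoid H]

/-- A monoid in which the lengths of factorizations of each element into nonunits are bounded is a
BF-monoid. -/
theorem isBFMonoid_of_length_le
    (h : ∀ a : H, ∃ N : ℕ, ∀ l : List H, (∀ u ∈ l, ¬ IsUnit u) → l.prod = a → l.length ≤ N) :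
    IsBFMonoid H := by
  classical
  refine ⟨fun a ha => ?_, fun a => ?_⟩
  · obtain ⟨N, hN⟩ := h a
    let P : ℕ → Prop := fun k => ∃ l : List H, (∀ u ∈ l, ¬ IsUnit u) ∧ l.prod = a ∧ l.length = k
    have hP : P 1 := ⟨[a], by simpa using ha, by simp, rfl⟩
    have h1 : 1 ≤ N := by simpa using hN [a] (by simpa using ha) (by simp)
    obtain ⟨l, hl, hla, hlen⟩ : P (Nat.findGreatest P N) := Nat.findGreatest_spec h1 hP
    -- A factorization with the largest number of nonunits consists of atoms: splitting a factor
    -- would lengthen it.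
    refine ⟨l, fun u hu => ⟨hl u hu, fun b c hbc => ?_⟩, hla⟩
    by_contra! hcon
    obtain ⟨s, t, rfl⟩ := List.append_of_mem hu
    have hmem : ∀ x ∈ s ++ b :: c :: t, ¬ IsUnit x := by
      intro x hx
      simp only [List.mem_append, List.mem_cons] at hx
      rcases hx with hx | rfl | rfl | hx
      · exact hl x (by simp [hx])
      · exact hcon.1
      · exact hcon.2
      · exact hl x (by simp [hx])
    have hprod : (s ++ b :: c :: t).prod = a := by
      rw [← hla, hbc]; simp [mul_assoc]
    have hle := Nat.le_findGreatest (P := P) (hN _ hmem hprod) ⟨_, hmem, hprod, rfl⟩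
    rw [← hlen] at hle
    simp at hle
  · obtain ⟨N, hN⟩ := h a
    refine (Set.finite_Iic N).subset ?_
    rintro k (⟨-, rfl⟩ | ⟨-, l, hl, hla, rfl⟩)
    · exact Nat.zero_le N
    · exact hN l (fun u hu => (hl u hu).not_isUnit) hla

/-- A monoid is a BF-monoid if each element admits an `ℕ`-valued function on its right divisors
that strictly increases under left multiplication by nonunits. -/
theorem isBFMonoid_of_potential
    (h : ∀ a : H, ∃ f : H → ℕ, ∀ v u c : H, v * (u * c) = a → ¬ IsUnit u → f c < f (u * c)) :
    IsBFMonoid H := by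
  refine isBFMonoid_of_length_le fun a => ?_
  obtain ⟨f, hf⟩ := h a
  -- The prefix `v` keeps every tail product a right divisor of `a`, where the potential is
  -- controlled.
  have key : ∀ (l : List H) (v : H), (∀ u ∈ l, ¬ IsUnit u) → v * l.prod = a →
      l.length ≤ f l.prod := by
    intro l
    induction l with
    | nil => intro v _ _; exact Nat.zero_le _
    | cons u l ih =>
      intro v hl hv
      rw [List.prod_cons] at hv ⊢
      have h1 := ih (v * u) (fun x hx => hl x (List.mem_cons_of_mem _ hx)) (by rw [mul_assoc, hv])
      have h2 := hf v u l.prod hv (hl u List.mem_cons_self)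
      rw [List.length_cons]
      omega
  exact ⟨f a, fun l hl hla => hla ▸ key l 1 hl (by rw [one_mul, hla])⟩

end Factorizations

/-! ### Left ideals of simple artinian rings -/

section SimpleArtinian

/-- Over a simple artinian ring `D`, some power of a proper left ideal `N` is generated by fewer
elements than its exponent. -/
theorem exists_surjective_pi_of_ne_top {D : Type*} [Ring D] [IsSimpleRing D] [IsArtinianRing D]
    (N : Ideal D) (hN : N ≠ ⊤) :
    ∃ m l : ℕ, m < l ∧ ∃ f : (Fin m → D) →ₗ[D] (Fin l → N), Function.Surjective f := by
  -- With `S` the simple module, `D ≅ S^l` and `N ≅ S^m` with `m < l`; hence `D^m ≅ S^(lm) ≅ N^l`.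
  have hiso : IsIsotypic D D := IsSimpleRing.isIsotypic D D
  obtain ⟨l, -, S, hS, ⟨e⟩⟩ := hiso.linearEquiv_fun
  have hN' : IsIsotypicOfType D N S :=
    IsIsotypicOfType.of_injective (hiso S) N.subtype N.subtype_injective
  obtain ⟨m, ⟨e'⟩⟩ := hN'.linearEquiv_fun
  have hlen := Submodule.length_lt hN
  have h1 : Module.length D D = l := by
    rw [e.length_eq, Module.length_pi_of_fintype]; simp [Module.length_eq_one]
  have h2 : Module.length D N = m := by
    rw [e'.length_eq, Module.length_pi_of_fintype]; simp [Module.length_eq_one]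
  rw [h1, h2] at hlen
  refine ⟨m, l, by exact_mod_cast hlen, ?_⟩
  let g : (Fin m → D) →ₗ[D] (Fin l → Fin m → S) :=
    { toFun := fun x i j => e (x j) i
      map_add' := fun x y => by ext; simp
      map_smul' := fun c x => by
        funext i j
        exact congrFun (map_smul e c (x j)) i }
  let k : (Fin l → Fin m → S) →ₗ[D] (Fin l → N) :=
    { toFun := fun x i => e'.symm (x i)
      map_add' := fun x y => by ext; simp
      map_smul' := fun c x => by ext; simp }
  refine ⟨k.comp g, Function.Surjective.comp (g := k) ?_ ?_⟩
  · intro y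
    exact ⟨fun i => e' (y i), by ext i; simp [k]⟩
  · intro y
    exact ⟨fun j => e.symm (fun i => y i j), by ext i j; simp [g]⟩

end SimpleArtinian

/-! ### Finite length over noetherian local Asano orders -/

section LocalAsano

variable {Q : Type*} [Ring Q]

/-- If the Jacobson radical `J` is invertible and the left ideal `K` is `J`-saturated, then
`K ∩ J = J K`. -/
theorem mem_jacobson_smul_of_saturated {T : Subring Q} (hT : IsAsanoOrder T) (K : Ideal T)
    (hJ : Ring.jacobson T ≠ ⊥) (hK : ∀ x : T, (∀ j ∈ Ring.jacobson T, j * x ∈ K) → x ∈ K)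
    {x : T} (hxK : x ∈ K) (hxJ : x ∈ Ring.jacobson T) : x ∈ Ring.jacobson T • K := by
  set J := Ring.jacobson T with hJdef
  have hmem : ∀ y : T, y ∈ J.toTwoSided ↔ y ∈ J := fun y => Ideal.mem_toTwoSided
  obtain ⟨X, hXJ, hJX⟩ := hT.2 J.toTwoSided (by
    intro h
    refine hJ (le_bot_iff.mp fun y hy => ?_)
    have := (hmem y).mpr hy
    rw [h] at this
    exact this)
  have hjX : ∀ j ∈ J, ∀ y ∈ X, (j : Q) * y ∈ T := by
    intro j hj y hy
    have : (j : Q) * y ∈ (T : Set Q) := by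
      rw [← hJX]
      exact AddSubgroup.subset_closure
        (Set.mul_mem_mul ⟨j, (hmem j).mpr hj, rfl⟩ hy)
    exact this
  have hXj : ∀ j ∈ J, ∀ y ∈ X, y * (j : Q) ∈ T := by
    intro j hj y hy
    have : y * (j : Q) ∈ (T : Set Q) := by
      rw [← hXJ]
      exact AddSubgroup.subset_closure
        (Set.mul_mem_mul hy ⟨j, (hmem j).mpr hj, rfl⟩)
    exact this
  -- Write `1 = ∑ j y` with `j ∈ J`, `y ∈ X`, so that `x = ∑ j (y x)`. Here `y x ∈ T` because `x ∈
  -- J`, and saturation gives `y x ∈ K`, since `J y ⊆ T` and `x ∈ K`.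
  have key : ∀ q ∈ addProd (inQ T (J.toTwoSided : Set T)) (X : Set Q),
      ∃ z ∈ J • K, (z : Q) = q * x := by
    intro q hq
    induction hq using AddSubgroup.closure_induction with
    | mem q hq =>
      obtain ⟨_, ⟨j, hj, rfl⟩, y, hy, rfl⟩ := hq
      have hj' := (hmem j).mp hj
      have hz : (⟨y * x, hXj x hxJ y hy⟩ : T) ∈ K := by
        refine hK _ fun j' hj' => ?_
        have : j' * (⟨y * x, hXj x hxJ y hy⟩ : T) = ⟨j' * y, hjX j' hj' y hy⟩ * x :=
          Subtype.ext (mul_assoc _ _ _).symm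
        rw [this]
        exact K.mul_mem_left _ hxK
      exact ⟨j • ⟨y * x, hXj x hxJ y hy⟩, Submodule.smul_mem_smul hj' hz,
        by simp [mul_assoc]⟩
    | zero => exact ⟨0, zero_mem _, by simp⟩
    | add p q _ _ hp hq =>
      obtain ⟨z, hz, hz'⟩ := hp
      obtain ⟨w, hw, hw'⟩ := hq
      exact ⟨z + w, add_mem hz hw, by simp [hz', hw', add_mul]⟩
    | neg q _ hq =>
      obtain ⟨z, hz, hz'⟩ := hq
      exact ⟨-z, neg_mem hz, by simp [hz']⟩
  obtain ⟨z, hz, hzx⟩ := key 1 (by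
    have : (1 : Q) ∈ (T : Set Q) := T.one_mem
    rw [← hJX] at this
    exact this)
  rw [one_mul] at hzx
  rwa [← Subtype.ext hzx]

/-- Nakayama's lemma, in the form of a statement on generators. -/
theorem le_of_le_sup_jacobson_smul {A M : Type*} [Ring A] [AddCommGroup M] [Module A M]
    {N W : Submodule A M} (hN : N.FG) (h : N ≤ W ⊔ Ring.jacobson A • N) : N ≤ W := by
  have h1 : N.map W.mkQ = ⊥ := by
    refine Submodule.FG.eq_bot_of_le_jacobson_smul (hN.map _) ?_
    calc N.map W.mkQ ≤ (W ⊔ Ring.jacobson A • N).map W.mkQ := Submodule.map_mono h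
      _ = Ring.jacobson A • N.map W.mkQ := by
        rw [Submodule.map_sup, Submodule.mkQ_map_self, bot_sup_eq, Submodule.map_smul'']
  rwa [← LinearMap.le_ker_iff_map, Submodule.ker_mkQ] at h1

/-- A left ideal of a local ring that meets the radical `J` in `J K` and contains a unit of the
quotient ring is improper. -/
theorem eq_top_of_inf_jacobson_le [Nontrivial Q] [IsArtinianRing Q] {T : Subring Q}
    [IsNoetherianRing T] (hT : IsLocalSimpleArtinian T) (K : Ideal T)
    (hK : ∀ x ∈ K, x ∈ Ring.jacobson T → x ∈ Ring.jacobson T • K)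
    {a : T} (ha : a ∈ K) (hau : IsUnit (a : Q)) : K = ⊤ := by
  classical
  set J := Ring.jacobson T with hJdef
  have : IsSimpleRing (T ⧸ J) := hT.1
  have : IsArtinianRing (T ⧸ J) := hT.2
  let π := Ideal.Quotient.mk J
  have hπ : Function.Surjective π := Ideal.Quotient.mk_surjective
  let N : Ideal (T ⧸ J) := K.map π
  have hNmem : ∀ y : T ⧸ J, y ∈ N ↔ ∃ k ∈ K, π k = y :=
    fun y => Ideal.mem_map_iff_of_surjective π hπ
  by_cases hN : N = ⊤
  -- Here `K + J = T`, and Nakayama applies.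
  · refine top_le_iff.mp (le_of_le_sup_jacobson_smul (A := T) (M := T) ⟨{1}, by simp⟩ ?_)
    intro t _
    obtain ⟨k, hk, hkt⟩ := (hNmem (π t)).mp (hN ▸ Submodule.mem_top)
    have : t - k ∈ J := by
      rw [← Ideal.Quotient.eq_zero_iff_mem, map_sub]
      exact sub_eq_zero.mpr hkt.symm
    have h2 : t = k + (t - k) := by abel
    rw [h2]
    refine Submodule.add_mem_sup hk ?_
    simpa using Submodule.smul_mem_smul this (Submodule.mem_top (x := (1 : T)))
  -- The hypothesis identifies `K / JK` with the proper left ideal `N`, so by Nakayama `K^l` is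
  -- generated by `m < l` vectors. As `K` contains a unit of `Q`, these vectors span `Q^l`, which is
  -- impossible over an artinian ring.
  · exfalso
    obtain ⟨m, l, hml, f, hf⟩ := exists_surjective_pi_of_ne_top N hN
    have hw : ∀ (j : Fin m) (i : Fin l), ∃ k ∈ K, π k = (f (Pi.single j 1) i : T ⧸ J) :=
      fun j i => (hNmem _).mp (f (Pi.single j 1) i).2
    choose w hwK hwπ using hw
    let KK : Submodule T (Fin l → T) := Submodule.pi Set.univ fun _ => K
    let W : Submodule T (Fin l → T) := Submodule.span T (Set.range w)
    have hle : KK ≤ W := by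
      refine le_of_le_sup_jacobson_smul (IsNoetherian.noetherian _) ?_
      intro x hx
      have hx' : ∀ i, x i ∈ K := fun i => hx i trivial
      obtain ⟨d, hd⟩ := hf fun i => ⟨π (x i), (hNmem _).mpr ⟨x i, hx' i, rfl⟩⟩
      choose t ht using fun j => hπ (d j)
      have hsum : ∑ j, t j • w j ∈ W :=
        sum_mem fun j _ => W.smul_mem _ (Submodule.subset_span ⟨j, rfl⟩)
      have hdf : f d = ∑ j, d j • f (Pi.single j 1) := by
        conv_lhs => rw [pi_eq_sum_univ' d]
        rw [map_sum]
        refine Finset.sum_congr rfl fun j _ => ?_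
        rw [map_smul]
      have hdiff : ∀ i, (x - ∑ j, t j • w j) i ∈ J • K := by
        intro i
        have e1 : (x - ∑ j, t j • w j) i = x i - ∑ j, t j * w j i := by simp
        rw [e1]
        refine hK _ (K.sub_mem (hx' i) (sum_mem fun j _ => K.mul_mem_left _ (hwK j i))) ?_
        rw [← Ideal.Quotient.eq_zero_iff_mem, map_sub, sub_eq_zero, map_sum]
        have h3 := congrArg (fun g => ((g i : N) : T ⧸ J)) (hdf.symm.trans hd)
        simp only [Finset.sum_apply, Pi.smul_apply, AddSubmonoidClass.coe_finsetSum,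
          Submodule.coe_smul, smul_eq_mul] at h3
        rw [show Ideal.Quotient.mk J (x i) = π (x i) from rfl, ← h3]
        refine Finset.sum_congr rfl fun j _ => ?_
        rw [map_mul, ← hwπ j i, ← ht j]
      have h2 : x = ∑ j, t j • w j + (x - ∑ j, t j • w j) := by abel
      rw [h2]
      refine Submodule.add_mem_sup hsum ?_
      rw [← LinearMap.sum_single_apply (fun _ => T) (x - ∑ j, t j • w j)]
      refine sum_mem fun i _ => ?_
      have h4 : J • K ≤ (J • KK).comap (LinearMap.single T (fun _ : Fin l => T) i) := by
        rw [Submodule.smul_le]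
        intro r hr k hk
        rw [Submodule.mem_comap, map_smul]
        refine Submodule.smul_mem_smul hr fun i' _ => ?_
        by_cases h : i' = i
        · subst h; simpa using hk
        · simp [Pi.single_eq_of_ne h]
      exact h4 (hdiff i)
    let g : (Fin m → Q) →ₗ[Q] (Fin l → Q) :=
      { toFun := fun c i => ∑ j, c j * (w j i : Q)
        map_add' := fun c d => by ext i; simp [add_mul, Finset.sum_add_distrib]
        map_smul' := fun c d => by ext i; simp [Finset.mul_sum, mul_assoc] }
    have hWg : ∀ x ∈ W, (fun i => (x i : Q)) ∈ LinearMap.range g := by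
      intro x hx
      induction hx using Submodule.span_induction with
      | mem x hx =>
        obtain ⟨j, rfl⟩ := hx
        refine ⟨Pi.single j 1, ?_⟩
        ext i
        simp [g, Pi.single_apply]
      | zero => exact zero_mem (LinearMap.range g)
      | add x y _ _ hx hy => exact add_mem hx hy
      | smul t x _ hx => exact (LinearMap.range g).smul_mem (t : Q) hx
    have hg : Function.Surjective g := by
      rw [← LinearMap.range_eq_top, eq_top_iff]
      intro y _
      obtain ⟨u, hu⟩ := hau
      have hy : y = ∑ i, (y i * (↑u⁻¹ : Q)) • (Pi.single i (a : Q) : Fin l → Q) := by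
        ext i
        simp [Pi.single_apply, ← hu]
      rw [hy]
      refine sum_mem fun i _ => Submodule.smul_mem _ _ ?_
      have h5 : (Pi.single i a : Fin l → T) ∈ KK := by
        intro i' _
        by_cases h : i' = i
        · subst h; simpa using ha
        · simp [Pi.single_eq_of_ne h]
      have h6 := hWg _ (hle h5)
      convert h6 using 1
      ext i'
      by_cases h : i' = i
      · subst h; simp
      · simp [Pi.single_eq_of_ne h]
    exact absurd (le_of_fin_surjective Q g hg) (not_le.mpr hml)

/-- A noetherian module over a local ring that is annihilated by the radical is artinian. -/
theorem isArtinian_of_isTorsionBySet_jacobson {A M : Type*} [Ring A] [AddCommGroup M]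
    [Module A M] [IsNoetherian A M] (hA : IsLocalSimpleArtinian A)
    (hM : Module.IsTorsionBySet A M (Ring.jacobson A : Set A)) : IsArtinian A M := by
  have : IsSimpleRing (A ⧸ Ring.jacobson A) := hA.1
  have : IsArtinianRing (A ⧸ Ring.jacobson A) := hA.2
  -- The module lives over the semisimple ring `A / J`; semisimple and noetherian imply artinian.
  let _ := hM.module
  have : IsSemisimpleModule A M :=
    (hM.semilinearMap.isSemisimpleModule_iff_of_bijective Function.bijective_id).2 inferInstance
  infer_instance

/-- For a noetherian local Asano order `T` and `a ∈ T` regular, `T / T a` has finite length. -/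
theorem isArtinian_quotient_of_local_asano [Nontrivial Q] [IsArtinianRing Q] {T : Subring Q}
    [IsNoetherianRing T] (hloc : IsLocalSimpleArtinian T) (hT : IsAsanoOrder T)
    (a : T) (hau : IsUnit (a : Q)) (K : Ideal T) (ha : a ∈ K) : IsArtinian T (T ⧸ K) := by
  induction K using WellFoundedGT.induction with
  | ind K ih =>
  -- `Y / K` is the part of `T / K` killed by the radical. Either it is nonzero and noetherian
  -- induction applies to `Y`, or `K` is saturated and must be improper.
  let Y : Ideal T :=
    { carrier := {x | ∀ j ∈ Ring.jacobson T, j * x ∈ K}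
      add_mem' := fun {x y} hx hy j hj => by
        rw [mul_add]; exact K.add_mem (hx j hj) (hy j hj)
      zero_mem' := fun j _ => by simp
      smul_mem' := fun t x hx j hj => by
        rw [smul_eq_mul, ← mul_assoc]
        exact hx _ (Ideal.mul_mem_right _ _ hj) }
  have hKY : K ≤ Y := fun x hx j _ => K.mul_mem_left j hx
  rcases eq_or_lt_of_le hKY with h | h
  · have hsat : ∀ x : T, (∀ j ∈ Ring.jacobson T, j * x ∈ K) → x ∈ K := by
      intro x hx
      rw [h]
      exact hx
    have : K = ⊤ := by
      -- A zero radical is not covered by invertibility, but then saturation alone puts `1` into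
      -- `K`.
      by_cases hJ : Ring.jacobson T = ⊥
      · refine (Ideal.eq_top_iff_one K).mpr (hsat 1 fun j hj => ?_)
        rw [hJ, Submodule.mem_bot] at hj
        simp [hj]
      · exact eq_top_of_inf_jacobson_le hloc K
          (fun x hx hxJ => mem_jacobson_smul_of_saturated hT K hJ hsat hx hxJ) ha hau
    subst this
    infer_instance
  · have h1 := ih Y h (hKY ha)
    rw [isArtinian_iff_submodule_quotient (Submodule.map K.mkQ Y)]
    constructor
    · refine isArtinian_of_isTorsionBySet_jacobson hloc ?_
      rintro ⟨_, y, hy, rfl⟩ ⟨j, hj⟩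
      refine Subtype.ext ?_
      change j • K.mkQ y = 0
      rw [← map_smul, Submodule.mkQ_apply, Submodule.Quotient.mk_eq_zero]
      exact hy j hj
    · exact ((Submodule.quotientQuotientEquivQuotient K Y hKY).isArtinian_iff).mpr h1

end LocalAsano

/-! ### Regular elements of orders -/

section OrderBasics

variable {Q : Type*} [Ring Q] {R : Subring Q}

/-- A regular element of an order that has a left inverse in the order is a unit. -/
theorem isUnit_of_left_inv_mem (hR : IsOrder R) (u : nonZeroDivisors R) (v : Q) (hv : v ∈ R)
    (h : v * ((u : R) : Q) = 1) : IsUnit u := by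
  have hu := hR.isUnit_of_regular u u.2
  have h' : ((u : R) : Q) * v = 1 := by
    refine hu.mul_right_cancel ?_
    rw [mul_assoc, h, mul_one, one_mul]
  let w : Rˣ := ⟨u, ⟨v, hv⟩, Subtype.ext h', Subtype.ext h⟩
  have hw : (⟨v, hv⟩ : R) ∈ nonZeroDivisors R := (Units.isUnit w⁻¹).mem_nonZeroDivisors
  exact ⟨⟨u, ⟨⟨v, hv⟩, hw⟩, Subtype.ext (Subtype.ext h'), Subtype.ext (Subtype.ext h)⟩, rfl⟩

/-- The left ideal generated by a regular element of an order is essential. -/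
theorem isEssentialSubmodule_span_singleton (hR : IsOrder R) (c : R) (hc : c ∈ nonZeroDivisors R) :
    IsEssentialSubmodule (Ideal.span {c} : Ideal R) := by
  intro J hJ
  refine (Submodule.eq_bot_iff J).mpr fun x hx => ?_
  obtain ⟨w, hw⟩ := hR.isUnit_of_regular c hc
  obtain ⟨y, d, hd, hdy⟩ := hR.left_fraction ((x : Q) * (↑w⁻¹ : Q))
  have h1 : d * x = y * c := by
    refine Subtype.ext ?_
    simp only [Subring.coe_mul]
    rw [← hdy, ← hw]
    simp [mul_assoc]
  have h2 : d * x ∈ (Ideal.span {c} : Ideal R) ⊓ J :=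
    Submodule.mem_inf.mpr
      ⟨Ideal.mem_span_singleton'.mpr ⟨y, h1.symm⟩, J.smul_mem d hx⟩
  rw [hJ, Submodule.mem_bot] at h2
  exact hd.1 x h2

/-- In a bounded order, the left ideal generated by a regular element contains a nonzero ideal. -/
theorem exists_ideal_le_span_singleton (hR : IsOrder R) (hb : IsBoundedRing R) (c : R)
    (hc : c ∈ nonZeroDivisors R) :
    ∃ A : TwoSidedIdeal R, A ≠ ⊥ ∧ ∀ x ∈ A, ∃ r : R, x = r * c := by
  obtain ⟨A, hA, h⟩ := hb.2 _ (isEssentialSubmodule_span_singleton hR c hc)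
  refine ⟨A, hA, fun x hx => ?_⟩
  obtain ⟨r, hr⟩ := Ideal.mem_span_singleton'.mp (h x hx)
  exact ⟨r, hr.symm⟩

end OrderBasics

/-! ### Simple essential overrings of bounded orders -/

section SimpleOverrings

variable {Q : Type*} [Ring Q] {R T : Subring Q}

/-- Regular elements of a bounded order become invertible in its simple essential overrings. -/
theorem exists_left_inv_of_simple_essential (hR : IsOrder R) (hb : IsBoundedRing R)
    (hT : IsEssentialOverring R T) (hs : IsSimpleRing T) (c : R) (hc : c ∈ nonZeroDivisors R) :
    ∃ t ∈ T, t * (c : Q) = 1 := by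
  obtain ⟨A, hA, hAc⟩ := exists_ideal_le_span_singleton hR hb c hc
  obtain ⟨hRT, F, G, hF, hG, hTF, hGT⟩ := hT
  obtain ⟨a, haA, ha0⟩ : ∃ a ∈ A, a ≠ 0 := by
    by_contra! h
    exact hA (le_bot_iff.mp fun x hx => by
      rw [h x hx]; exact zero_mem _)
  let a' : T := ⟨a, hRT a.2⟩
  have h1 : (1 : T) ∈ TwoSidedIdeal.span {a'} := by
    refine IsSimpleRing.one_mem_of_ne_zero_mem _ (x := a') ?_
      (TwoSidedIdeal.subset_span (Set.mem_singleton _))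
    intro h
    have h' : (a : Q) = 0 := congrArg Subtype.val h
    exact ha0 (Subtype.ext h')
  rw [TwoSidedIdeal.mem_span_iff_mem_addSubgroup_closure] at h1
  -- By simplicity `1` is a sum of terms `s a s'`. Clearing the coefficients with the two Gabriel
  -- topologies gives `J I ⊆ A ⊆ Rc`.
  have key : ∀ t : T, t ∈ AddSubgroup.closure ((Set.univ : Set T) * {a'} * (Set.univ : Set T)) →
      ∃ J ∈ G, ∃ I ∈ F, ∀ x ∈ J, ∀ y ∈ I, ∃ z ∈ A, (z : Q) = x * t * y := by
    intro t ht
    induction ht using AddSubgroup.closure_induction with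
    | mem t ht =>
      obtain ⟨_, ⟨s, -, _, rfl, rfl⟩, s', -, rfl⟩ := ht
      obtain ⟨J, hJ, hJs⟩ := (hG.mem_iff s).mp s.2
      obtain ⟨I, hI, hIs⟩ := (hF.mem_iff s').mp s'.2
      refine ⟨J, hJ, I, hI, fun x hx y hy =>
        ⟨⟨_, hJs x hx⟩ * a * ⟨_, hIs y hy⟩, A.mul_mem_right _ _ (A.mul_mem_left _ _ haA), ?_⟩⟩
      simp [a', mul_assoc]
    | zero =>
      exact ⟨⊤, hG.isGabriel.top_mem, ⊤, hF.isGabriel.top_mem, fun x _ y _ =>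
        ⟨0, zero_mem _, by simp⟩⟩
    | add s t _ _ hs ht =>
      obtain ⟨J, hJ, I, hI, h⟩ := hs
      obtain ⟨J', hJ', I', hI', h'⟩ := ht
      refine ⟨J ⊓ J', hG.isGabriel.inf_mem _ hJ _ hJ', I ⊓ I', hF.isGabriel.inf_mem _ hI _ hI',
        fun x hx y hy => ?_⟩
      obtain ⟨z, hz, e⟩ := h x hx.1 y hy.1
      obtain ⟨z', hz', e'⟩ := h' x hx.2 y hy.2
      exact ⟨z + z', add_mem hz hz', by simp [e, e', mul_add, add_mul]⟩
    | neg t _ ht =>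
      obtain ⟨J, hJ, I, hI, h⟩ := ht
      refine ⟨J, hJ, I, hI, fun x hx y hy => ?_⟩
      obtain ⟨z, hz, e⟩ := h x hx y hy
      exact ⟨-z, neg_mem hz, by simp [e]⟩
  obtain ⟨J, hJ, I, hI, hJI⟩ := key 1 h1
  let Tc : AddSubgroup Q := T.toAddSubgroup.map (AddMonoidHom.mulRight (c : Q))
  have hTc : ∀ q : Q, q ∈ Tc ↔ ∃ t ∈ T, t * (c : Q) = q := fun q => Iff.rfl
  have hTJI : ∀ y ∈ I, ∀ q ∈ T, q * (y : Q) ∈ Tc := by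
    intro y hy q hq
    have hq' : q ∈ addProd (T : Set Q) (inQ R (J : Set R)) := by
      have : q ∈ (T : Set Q) := hq
      rw [← hG.perfect J hJ] at this
      exact this
    have hle : addProd (T : Set Q) (inQ R (J : Set R)) ≤
        Tc.comap (AddMonoidHom.mulRight (y : Q)) := by
      refine (AddSubgroup.closure_le _).mpr ?_
      rintro _ ⟨t, ht, _, ⟨x, hx, rfl⟩, rfl⟩
      obtain ⟨z, hz, e⟩ := hJI x hx y hy
      obtain ⟨r, rfl⟩ := hAc z hz
      refine (hTc _).mpr ⟨t * r, T.mul_mem ht (hRT r.2), ?_⟩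
      simp only [Subring.coe_mul, Subring.coe_one, mul_one] at e
      simp [mul_assoc, e]
    exact hle hq'
  -- The mixed condition `T I = T` for the right topology is needed here: `T = T I = T J I ⊆ T c`.
  have h1T : (1 : Q) ∈ addProd (T : Set Q) (inQ R (I : Set R)) := by
    have : (1 : Q) ∈ (T : Set Q) := T.one_mem
    rw [← hTF I hI] at this
    exact this
  have hle : addProd (T : Set Q) (inQ R (I : Set R)) ≤ Tc := by
    refine (AddSubgroup.closure_le _).mpr ?_
    rintro _ ⟨t, ht, _, ⟨y, hy, rfl⟩, rfl⟩
    exact hTJI y hy t ht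
  exact hle h1T

end SimpleOverrings

/-! ### Colength of left ideals -/

section Length

variable {A : Type*} [Ring A] [IsNoetherianRing A]

/-- The length of `A / I` as a natural number. -/
noncomputable def colength (I : Ideal A) : ℕ := (Module.length A (A ⧸ I)).toNat

/-- `toNat` sends infinite length to `0`, so the artinian assumption is what makes the comparison
meaningful. -/
theorem colength_lt_of_lt {I I' : Ideal A} (hI : IsArtinian A (A ⧸ I)) (h : I < I') :
    colength I' < colength I := by
  have e := (Submodule.quotientQuotientEquivQuotient I I' h.le).length_eq
  have hne : Submodule.map I.mkQ I' ≠ ⊥ := by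
    rw [Ne, ← LinearMap.le_ker_iff_map, Submodule.ker_mkQ]
    exact h.not_ge
  have hlt := Submodule.length_quotient_lt _ hne
  rw [e] at hlt
  exact by
    unfold colength
    rw [← Nat.cast_lt (α := ℕ∞), ENat.natCast_toNat hlt.ne_top, ENat.natCast_toNat Module.length_ne_top]
    exact hlt

theorem colength_le_of_le {I I' : Ideal A} (hI : IsArtinian A (A ⧸ I)) (h : I ≤ I') :
    colength I' ≤ colength I := by
  rcases eq_or_lt_of_le h with rfl | h
  · exact le_rfl
  · exact (colength_lt_of_lt hI h).le

end Length

/-! ### Krull orders in the sense of Marubayashi -/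

section Marubayashi

variable {Q : Type*} [Ring Q] [Nontrivial Q] [IsArtinianRing Q] {R : Subring Q}

theorem isBFRing_of_isBoundedKrullMarubayashi (h : IsBoundedKrullMarubayashi R) : IsBFRing R := by
  classical
  obtain ⟨𝓡, 𝓢, hfam, hb⟩ := h
  have hR := hfam.isOrder
  have hRT : ∀ T ∈ 𝓡 ∪ 𝓢, R ≤ T := fun T hT => (hfam.essential T hT).1
  refine isBFMonoid_of_potential fun a => ?_
  let E : Finset (Subring Q) := (hfam.finite_left a a.2).toFinset
  have hE : ∀ T, T ∈ E ↔ T ∈ 𝓡 ∧ (addProd (T : Set Q) {((a : R) : Q)} : Set Q) ≠ T := by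
    intro T; simp [E]
  -- `gen T c` is `Tc`. The default `⊤` only makes it total; for overrings of `R` it never occurs.
  let gen : (T : Subring Q) → nonZeroDivisors R → Ideal T := fun T c =>
    if h : ((c : R) : Q) ∈ T then Ideal.span {⟨_, h⟩} else ⊤
  refine ⟨fun c => ∑ T ∈ E, colength (gen T c), fun v u c hvuc hu => ?_⟩
  have hau : IsUnit (((a : R) : Q)) := hR.isUnit_of_regular a a.2
  have hcu : IsUnit (((c : R) : Q)) := hR.isUnit_of_regular c c.2
  have hprod : ((a : R) : Q) = ((v : R) : Q) * (((u : R) : Q) * ((c : R) : Q)) := by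
    rw [← hvuc]; rfl
  have hstep : ∀ T ∈ E, gen T (u * c) ≤ gen T c ∧ IsArtinian T (T ⧸ gen T (u * c)) ∧
      (gen T (u * c) = gen T c → ∃ t ∈ T, t * ((u : R) : Q) = 1) := by
    intro T hTE
    have hT𝓡 := ((hE T).mp hTE).1
    have hle := hRT T (Or.inl hT𝓡)
    have hmem : ∀ r : nonZeroDivisors R, ((r : R) : Q) ∈ T := fun r => hle r.1.2
    have hgen : ∀ r : nonZeroDivisors R, gen T r = Ideal.span {⟨_, hmem r⟩} :=
      fun r => dif_pos (hmem r)
    obtain ⟨hnoeth, hloc, hasano⟩ := hfam.noetherian_local_asano T hT𝓡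
    have : IsNoetherianRing T := hnoeth.1
    refine ⟨?_, ?_, ?_⟩
    · rw [hgen, hgen, Ideal.span_singleton_le_iff_mem, Ideal.mem_span_singleton']
      exact ⟨⟨_, hmem u⟩, rfl⟩
    · refine isArtinian_quotient_of_local_asano hloc hasano ⟨_, hmem a⟩ hau _ ?_
      rw [hgen, Ideal.mem_span_singleton']
      exact ⟨⟨_, hmem v⟩, Subtype.ext hprod.symm⟩
    · intro heq
      have hc : (⟨_, hmem c⟩ : T) ∈ gen T (u * c) := by
        rw [heq, hgen]; exact Ideal.mem_span_singleton_self _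
      rw [hgen, Ideal.mem_span_singleton'] at hc
      obtain ⟨t, ht⟩ := hc
      refine ⟨t, t.2, hcu.mul_right_cancel ?_⟩
      have := congrArg Subtype.val ht
      rw [one_mul, mul_assoc]
      exact this
  have hnoeth : ∀ T ∈ E, IsNoetherianRing T := fun T hT =>
    (hfam.noetherian_local_asano T ((hE T).mp hT).1).1.1
  have hmono : ∀ T ∈ E, colength (gen T c) ≤ colength (gen T (u * c)) := by
    intro T hT
    have := hnoeth T hT
    exact colength_le_of_le (hstep T hT).2.1 (hstep T hT).1
  -- All summands are monotone, so if the sum does not grow then each is stationary, and the inverse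
  -- of `u` has to be found in every overring of the family.
  by_contra hcon
  refine hu (isUnit_of_left_inv_mem hR u (Ring.inverse ((u : R) : Q)) ?_
    (Ring.inverse_mul_cancel _ (hR.isUnit_of_regular u u.2)))
  have huu : IsUnit (((u : R) : Q)) := hR.isUnit_of_regular u u.2
  have hinv : ∀ T : Subring Q, (∃ t ∈ T, t * ((u : R) : Q) = 1) →
      Ring.inverse ((u : R) : Q) ∈ T := by
    rintro T ⟨t, ht, htu⟩
    have : t = Ring.inverse ((u : R) : Q) := by
      refine huu.mul_right_cancel ?_
      rw [htu, Ring.inverse_mul_cancel _ huu]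
    rwa [← this]
  refine hfam.eq_sInf.ge (Subring.mem_sInf.mpr fun T hT => ?_)
  refine hinv T ?_
  by_cases hTE : T ∈ E
  · have := hnoeth T hTE
    refine (hstep T hTE).2.2 (by_contra fun hne => hcon ?_)
    exact Finset.sum_lt_sum hmono ⟨T, hTE, colength_lt_of_lt (hstep T hTE).2.1
      (lt_of_le_of_ne (hstep T hTE).1 hne)⟩
  rcases hT with hT | hT
  · have hTa : (addProd (T : Set Q) {((a : R) : Q)} : Set Q) = T := by
      by_contra hne
      exact hTE ((hE T).mpr ⟨hT, hne⟩)
    have hle := hRT T (Or.inl hT)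
    have h1 : (1 : Q) ∈ addProd (T : Set Q) {((a : R) : Q)} := by
      have : (1 : Q) ∈ (T : Set Q) := T.one_mem
      rw [← hTa] at this
      exact this
    have h2 : addProd (T : Set Q) {((a : R) : Q)} ≤
        T.toAddSubgroup.map (AddMonoidHom.mulRight ((a : R) : Q)) := by
      refine (AddSubgroup.closure_le _).mpr ?_
      rintro _ ⟨t, ht, _, rfl, rfl⟩
      exact ⟨t, ht, rfl⟩
    obtain ⟨t, ht, hta⟩ := h2 h1
    have hta' : t * ((v : R) : Q) * ((u : R) : Q) * ((c : R) : Q) = 1 := by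
      rw [← hta, AddMonoidHom.mulRight_apply, hprod]; simp only [mul_assoc]
    -- From `t v u c = 1` and the invertibility of `c` in `Q`, `t v u` is the inverse of `c`; hence
    -- `c t v u = 1`.
    refine ⟨((c : R) : Q) * (t * ((v : R) : Q)),
      T.mul_mem (hle c.1.2) (T.mul_mem ht (hle v.1.2)), hcu.mul_right_cancel ?_⟩
    rw [one_mul, mul_assoc, mul_assoc, ← mul_assoc (t * _), hta', mul_one]
  · rcases hb with hb | hb
    · exact exists_left_inv_of_simple_essential hR hb (hfam.essential T (Or.inr hT))
        (hfam.noetherian_simple T hT).2 u u.2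
    · simp [hb] at hT

end Marubayashi

/-! ### Divisorial ideals of maximal orders -/

section MaximalOrder

variable {Q : Type*} [Ring Q] {R : Subring Q}

/-- An additive subgroup of `Q` that is stable under multiplication by `R` from both sides. -/
structure IsBimodule (R : Subring Q) (X : AddSubgroup Q) : Prop where
  mul_left : ∀ r ∈ R, ∀ x ∈ X, r * x ∈ X
  mul_right : ∀ x ∈ X, ∀ r ∈ R, x * r ∈ X

/-- `{q | q X ⊆ R}`. -/
def leftInv (R : Subring Q) (X : AddSubgroup Q) : AddSubgroup Q where
  carrier := {q | ∀ x ∈ X, q * x ∈ R}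
  add_mem' {p q} hp hq x hx := by rw [add_mul]; exact R.add_mem (hp x hx) (hq x hx)
  zero_mem' x _ := by rw [zero_mul]; exact R.zero_mem
  neg_mem' {q} hq x hx := by rw [neg_mul]; exact R.neg_mem (hq x hx)

/-- `{q | X q ⊆ R}`. -/
def rightInv (R : Subring Q) (X : AddSubgroup Q) : AddSubgroup Q where
  carrier := {q | ∀ x ∈ X, x * q ∈ R}
  add_mem' {p q} hp hq x hx := by rw [mul_add]; exact R.add_mem (hp x hx) (hq x hx)
  zero_mem' x _ := by rw [mul_zero]; exact R.zero_mem
  neg_mem' {q} hq x hx := by rw [mul_neg]; exact R.neg_mem (hq x hx)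

/-- The divisorial closure of `X`. -/
def divClosure (R : Subring Q) (X : AddSubgroup Q) : AddSubgroup Q := rightInv R (leftInv R X)

theorem IsBimodule.leftInv {X : AddSubgroup Q} (hX : IsBimodule R X) :
    IsBimodule R (leftInv R X) where
  mul_left r hr q hq x hx := by rw [mul_assoc]; exact R.mul_mem hr (hq x hx)
  mul_right q hq r hr x hx := by rw [mul_assoc]; exact hq _ (hX.mul_left r hr x hx)

theorem IsBimodule.rightInv {X : AddSubgroup Q} (hX : IsBimodule R X) :
    IsBimodule R (rightInv R X) where
  mul_left r hr q hq x hx := by rw [← mul_assoc]; exact hq _ (hX.mul_right x hx r hr)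
  mul_right q hq r hr x hx := by rw [← mul_assoc]; exact R.mul_mem (hq x hx) hr

theorem IsBimodule.divClosure {X : AddSubgroup Q} (hX : IsBimodule R X) :
    IsBimodule R (divClosure R X) := hX.leftInv.rightInv

theorem IsBimodule.addProd {X Y : AddSubgroup Q} (hX : IsBimodule R X) (hY : IsBimodule R Y) :
    IsBimodule R (addProd (X : Set Q) (Y : Set Q)) where
  mul_left r hr q hq := by
    have h : BoundedKrull.addProd (X : Set Q) (Y : Set Q) ≤
        (BoundedKrull.addProd (X : Set Q) (Y : Set Q)).comap (AddMonoidHom.mulLeft r) := by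
      refine (AddSubgroup.closure_le _).mpr ?_
      rintro _ ⟨x, hx, y, hy, rfl⟩
      exact AddSubgroup.subset_closure
        ⟨r * x, hX.mul_left r hr x hx, y, hy, mul_assoc r x y⟩
    exact h hq
  mul_right q hq r hr := by
    have h : BoundedKrull.addProd (X : Set Q) (Y : Set Q) ≤
        (BoundedKrull.addProd (X : Set Q) (Y : Set Q)).comap (AddMonoidHom.mulRight r) := by
      refine (AddSubgroup.closure_le _).mpr ?_
      rintro _ ⟨x, hx, y, hy, rfl⟩
      exact AddSubgroup.subset_closure
        ⟨x, hx, y * r, hY.mul_right y hy r hr, (mul_assoc x y r).symm⟩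
    exact h hq

theorem mul_mem_addProd {X Y : AddSubgroup Q} {x y : Q} (hx : x ∈ X) (hy : y ∈ Y) :
    x * y ∈ addProd (X : Set Q) (Y : Set Q) :=
  AddSubgroup.subset_closure ⟨x, hx, y, hy, rfl⟩

theorem le_divClosure (X : AddSubgroup Q) : X ≤ divClosure R X := fun x hx _ hb => hb x hx

theorem one_mem_leftInv {X : AddSubgroup Q} (h : X ≤ R.toAddSubgroup) : (1 : Q) ∈ leftInv R X :=
  fun x hx => by rw [one_mul]; exact h hx

theorem divClosure_le {X : AddSubgroup Q} (h : X ≤ R.toAddSubgroup) :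
    divClosure R X ≤ R.toAddSubgroup := fun x hx => by
  have := hx 1 (one_mem_leftInv h)
  rwa [one_mul] at this

/-- A nonzero divisorial two-sided ideal of `R`. -/
structure IsDivisorial (R : Subring Q) (A : AddSubgroup Q) : Prop where
  bimodule : IsBimodule R A
  le : A ≤ R.toAddSubgroup
  ne_bot : A ≠ ⊥
  closure_le : divClosure R A ≤ A

theorem isDivisorial_divClosure {X : AddSubgroup Q} (hX : IsBimodule R X)
    (hle : X ≤ R.toAddSubgroup) (hne : X ≠ ⊥) : IsDivisorial R (divClosure R X) where
  bimodule := hX.divClosure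
  le := divClosure_le hle
  ne_bot h := hne (le_bot_iff.mp (h ▸ le_divClosure X))
  closure_le _ hx b hb := hx b fun _ hy => hy b hb

/-- An overring of an order is an order. -/
theorem IsOrder.of_le [IsArtinianRing Q] {S : Subring Q} (hR : IsOrder R) (h : R ≤ S) :
    IsOrder S := by
  have hreg : ∀ c ∈ nonZeroDivisors R, (⟨c, h c.2⟩ : S) ∈ nonZeroDivisors S := by
    intro c hc
    have hu := hR.isUnit_of_regular c hc
    refine ⟨fun x hx => Subtype.ext ?_, fun x hx => Subtype.ext ?_⟩
    · exact hu.mul_right_eq_zero.mp (congrArg Subtype.val hx)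
    · exact hu.mul_left_eq_zero.mp (congrArg Subtype.val hx)
  -- Clearing denominators shows that regular elements of `S` stay regular in `Q`, hence are units
  -- since `Q` is artinian.
  refine ⟨fun c hc => IsArtinianRing.isUnit_of_mem_nonZeroDivisors ⟨fun q hq => ?_, fun q hq => ?_⟩,
    fun q => ?_, fun q => ?_⟩
  · obtain ⟨a, d, hd, hda⟩ := hR.right_fraction q
    have h1 : c * (⟨a, h a.2⟩ : S) = 0 := Subtype.ext (by
      change (c : Q) * (a : Q) = 0
      rw [← hda, ← mul_assoc, hq, zero_mul])
    have h2 : (a : Q) = 0 := congrArg Subtype.val (hc.1 _ h1)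
    rw [h2] at hda
    exact (hR.isUnit_of_regular d hd).mul_left_eq_zero.mp hda
  · obtain ⟨a, d, hd, hda⟩ := hR.left_fraction q
    have h1 : (⟨a, h a.2⟩ : S) * c = 0 := Subtype.ext (by
      change (a : Q) * (c : Q) = 0
      rw [← hda, mul_assoc, hq, mul_zero])
    have h2 : (a : Q) = 0 := congrArg Subtype.val (hc.2 _ h1)
    rw [h2] at hda
    exact (hR.isUnit_of_regular d hd).mul_right_eq_zero.mp hda
  · obtain ⟨a, d, hd, hda⟩ := hR.right_fraction q
    exact ⟨⟨a, h a.2⟩, ⟨d, h d.2⟩, hreg d hd, hda⟩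
  · obtain ⟨a, d, hd, hda⟩ := hR.left_fraction q
    exact ⟨⟨a, h a.2⟩, ⟨d, h d.2⟩, hreg d hd, hda⟩

theorem IsOrder.exists_common_left_multiple (hR : IsOrder R) {c d : Q} (hc : IsUnit c)
    (hd : IsUnit d) (hdR : d ∈ R) :
    ∃ e ∈ R, ∃ f ∈ R, e * d = f * c ∧ IsUnit (e * d) ∧ e * d ∈ R := by
  obtain ⟨w, rfl⟩ := hc
  obtain ⟨f, e, he, hef⟩ := hR.left_fraction (d * (↑w⁻¹ : Q))
  refine ⟨e, e.2, f, f.2, ?_, (hR.isUnit_of_regular e he).mul hd, R.mul_mem e.2 hdR⟩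
  rw [← hef]
  simp [mul_assoc]

theorem IsOrder.exists_common_right_multiple (hR : IsOrder R) {c d : Q} (hc : IsUnit c)
    (hd : IsUnit d) (hdR : d ∈ R) :
    ∃ e ∈ R, ∃ f ∈ R, d * e = c * f ∧ IsUnit (d * e) ∧ d * e ∈ R := by
  obtain ⟨w, rfl⟩ := hc
  obtain ⟨f, e, he, hef⟩ := hR.right_fraction ((↑w⁻¹ : Q) * d)
  refine ⟨e, e.2, f, f.2, ?_, hd.mul (hR.isUnit_of_regular e he), R.mul_mem hdR e.2⟩
  rw [← hef]
  simp [← mul_assoc]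

/-- A nonzero ideal of an order in a simple ring contains a unit of the quotient ring. -/
theorem exists_isUnit_mem [IsSimpleRing Q] (hR : IsOrder R) {A : AddSubgroup Q}
    (hA : IsBimodule R A) (hne : A ≠ ⊥) : ∃ u : Qˣ, (u : Q) ∈ A := by
  obtain ⟨a, haA, ha0⟩ : ∃ a ∈ A, a ≠ 0 := by
    by_contra! h
    exact hne ((AddSubgroup.eq_bot_iff_forall A).mpr h)
  have h1 : (1 : Q) ∈ TwoSidedIdeal.span {a} :=
    IsSimpleRing.one_mem_of_ne_zero_mem _ ha0 (TwoSidedIdeal.subset_span (Set.mem_singleton _))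
  rw [TwoSidedIdeal.mem_span_iff_mem_addSubgroup_closure] at h1
  -- Every element of `QaQ = Q` is moved into `A` by unit denominators on both sides; common
  -- multiples handle sums. For `t = 1` the product `c d` is the unit sought.
  have key : ∀ t : Q, t ∈ AddSubgroup.closure ((Set.univ : Set Q) * {a} * Set.univ) →
      ∃ c ∈ R, ∃ d ∈ R, IsUnit c ∧ IsUnit d ∧ c * t * d ∈ A := by
    intro t ht
    induction ht using AddSubgroup.closure_induction with
    | mem t ht =>
      obtain ⟨_, ⟨s, -, b, hb, rfl⟩, s', -, rfl⟩ := ht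
      obtain ⟨x, c, hc, hcx⟩ := hR.left_fraction s
      obtain ⟨y, d, hd, hdy⟩ := hR.right_fraction s'
      refine ⟨c, c.2, d, d.2, hR.isUnit_of_regular c hc, hR.isUnit_of_regular d hd, ?_⟩
      have : (c : Q) * (s * b * s') * d = x * a * y := by
        rw [Set.mem_singleton_iff.mp hb, ← hcx, ← hdy]; simp only [mul_assoc]
      exact this ▸ hA.mul_right _ (hA.mul_left _ x.2 _ haA) _ y.2
    | zero => exact ⟨1, R.one_mem, 1, R.one_mem, isUnit_one, isUnit_one, by simp [zero_mem]⟩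
    | add s t _ _ hs ht =>
      obtain ⟨c, hc, d, hd, hcu, hdu, hs⟩ := hs
      obtain ⟨c', hc', d', hd', hcu', hdu', ht⟩ := ht
      obtain ⟨e, he, f, hf, hef, heu, hem⟩ := hR.exists_common_left_multiple hcu hcu' hc'
      obtain ⟨e', he', f', hf', hef', heu', hem'⟩ := hR.exists_common_right_multiple hdu hdu' hd'
      refine ⟨_, hem, _, hem', heu, heu', ?_⟩
      rw [mul_add, add_mul]
      refine A.add_mem ?_ ?_
      · have : e * c' * s * (d' * e') = f * (c * s * d) * f' := by
          rw [hef, hef']; simp only [mul_assoc]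
        exact this ▸ hA.mul_right _ (hA.mul_left _ hf _ hs) _ hf'
      · have : e * c' * t * (d' * e') = e * (c' * t * d') * e' := by simp only [mul_assoc]
        exact this ▸ hA.mul_right _ (hA.mul_left _ he _ ht) _ he'
    | neg t _ ht =>
      obtain ⟨c, hc, d, hd, hcu, hdu, ht⟩ := ht
      exact ⟨c, hc, d, hd, hcu, hdu, by simpa using ht⟩
  obtain ⟨c, -, d, -, hcu, hdu, h⟩ := key 1 h1
  rw [mul_one] at h
  exact ⟨(hcu.mul hdu).unit, h⟩

/-- A maximal element among the proper divisorial ideals. -/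
structure IsMaximalDivisorial (R : Subring Q) (P : AddSubgroup Q) : Prop where
  divisorial : IsDivisorial R P
  one_notMem : (1 : Q) ∉ P
  le_of_le : ∀ A, IsDivisorial R A → P ≤ A → (1 : Q) ∉ A → A ≤ P

/-- If the inverse were contained in `R`, then `1` would lie in the divisorial closure. -/
theorem IsDivisorial.exists_leftInv_notMem {A : AddSubgroup Q} (hA : IsDivisorial R A)
    (h1 : (1 : Q) ∉ A) : ∃ q ∈ leftInv R A, q ∉ R := by
  by_contra! h
  exact h1 (hA.closure_le fun b hb => by rw [mul_one]; exact h b hb)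

/-- Maximality of `P` forces the closure of the strictly larger ideal `B` to contain `1`, so the
inverse of `B` lies in `R`. -/
theorem IsMaximalDivisorial.leftInv_le {P B : AddSubgroup Q} (hP : IsMaximalDivisorial R P)
    (hB : IsBimodule R B) (hle : B ≤ R.toAddSubgroup) (hPB : P ≤ B) {z : Q} (hz : z ∈ B)
    (hzP : z ∉ P) {q : Q} (hq : q ∈ leftInv R B) : q ∈ R := by
  have hne : B ≠ ⊥ := fun h => hP.divisorial.ne_bot (le_bot_iff.mp (h ▸ hPB))
  by_cases h : (1 : Q) ∈ divClosure R B
  · have := h q hq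
    rwa [mul_one] at this
  · exact absurd (hP.le_of_le _ (isDivisorial_divClosure hB hle hne)
      (hPB.trans (le_divClosure B)) h (le_divClosure B hz)) hzP

/-- Maximal divisorial ideals are semiprime. -/
theorem IsMaximalDivisorial.semiprime {P : AddSubgroup Q} (hP : IsMaximalDivisorial R P) {z : Q}
    (hzR : z ∈ R) (hz : ∀ s ∈ R, z * s * z ∈ P) : z ∈ P := by
  by_contra hzP
  have hPb := hP.divisorial.bimodule
  -- `B` and the ideal `C` below satisfy `B C ⊆ P`, and both contain `P` and the element `z ∉ P`.
  let B : AddSubgroup Q :=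
    { carrier := {x | x ∈ R ∧ ∀ s ∈ R, x * s * z ∈ P}
      add_mem' := fun {x y} hx hy => ⟨R.add_mem hx.1 hy.1, fun s hs => by
        rw [add_mul, add_mul]; exact P.add_mem (hx.2 s hs) (hy.2 s hs)⟩
      zero_mem' := ⟨R.zero_mem, fun s _ => by simp [P.zero_mem]⟩
      neg_mem' := fun {x} hx => ⟨R.neg_mem hx.1, fun s hs => by
        rw [neg_mul, neg_mul]; exact P.neg_mem (hx.2 s hs)⟩ }
  have hB : IsBimodule R B :=
    ⟨fun r hr x hx => ⟨R.mul_mem hr hx.1, fun s hs => by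
      rw [mul_assoc r x s, mul_assoc r]; exact hPb.mul_left r hr _ (hx.2 s hs)⟩,
    fun x hx r hr => ⟨R.mul_mem hx.1 hr, fun s hs => by
      rw [mul_assoc x r s]; exact hx.2 _ (R.mul_mem hr hs)⟩⟩
  let C : AddSubgroup Q :=
    { carrier := {x | x ∈ R ∧ ∀ y ∈ B, y * x ∈ P}
      add_mem' := fun {x y} hx hy => ⟨R.add_mem hx.1 hy.1, fun s hs => by
        rw [mul_add]; exact P.add_mem (hx.2 s hs) (hy.2 s hs)⟩
      zero_mem' := ⟨R.zero_mem, fun s _ => by simp [P.zero_mem]⟩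
      neg_mem' := fun {x} hx => ⟨R.neg_mem hx.1, fun s hs => by
        rw [mul_neg]; exact P.neg_mem (hx.2 s hs)⟩ }
  have hC : IsBimodule R C :=
    ⟨fun r hr x hx => ⟨R.mul_mem hr hx.1, fun y hy => by
      rw [← mul_assoc]; exact hx.2 _ (hB.mul_right y hy r hr)⟩,
    fun x hx r hr => ⟨R.mul_mem hx.1 hr, fun y hy => by
      rw [← mul_assoc]; exact hPb.mul_right _ (hx.2 y hy) r hr⟩⟩
  have hPB : P ≤ B := fun x hx => ⟨hP.divisorial.le hx, fun s hs =>
    hPb.mul_right _ (hPb.mul_right x hx s hs) z hzR⟩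
  have hPC : P ≤ C := fun x hx => ⟨hP.divisorial.le hx, fun y hy => hPb.mul_left y hy.1 x hx⟩
  have hzB : z ∈ B := ⟨hzR, hz⟩
  have hzC : z ∈ C := ⟨hzR, fun y hy => by
    have := hy.2 1 R.one_mem
    rwa [mul_one] at this⟩
  obtain ⟨q, hq, hqR⟩ := hP.divisorial.exists_leftInv_notMem hP.one_notMem
  -- For `q` in the inverse of `P`, `q B C ⊆ R`; cancelling `C` and then `B` gives `q ∈ R`.
  refine hqR (hP.leftInv_le hB (fun x hx => hx.1) hPB hzB hzP fun y hy => ?_)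
  refine hP.leftInv_le hC (fun x hx => hx.1) hPC hzC hzP fun x hx => ?_
  rw [mul_assoc]
  exact hq _ (hx.2 y hy)

variable [IsSimpleRing Q] [IsArtinianRing Q]

/-- The left multiplier ring of a nonzero ideal of a maximal order is the order itself. -/
theorem IsMaximalOrder.mem_of_mul_left (hR : IsMaximalOrder R) {A : AddSubgroup Q}
    (hA : IsBimodule R A) (hle : A ≤ R.toAddSubgroup) (hne : A ≠ ⊥) {q : Q}
    (hq : ∀ x ∈ A, q * x ∈ A) : q ∈ R := by
  let S : Subring Q :=
    { carrier := {q | ∀ x ∈ A, q * x ∈ A}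
      mul_mem' := fun {p q} hp hq x hx => by rw [mul_assoc]; exact hp _ (hq x hx)
      one_mem' := fun x hx => by rwa [one_mul]
      add_mem' := fun {p q} hp hq x hx => by rw [add_mul]; exact A.add_mem (hp x hx) (hq x hx)
      zero_mem' := fun x _ => by rw [zero_mul]; exact A.zero_mem
      neg_mem' := fun {q} hq x hx => by rw [neg_mul]; exact A.neg_mem (hq x hx) }
  have hRS : R ≤ S := fun r hr x hx => hA.mul_left r hr x hx
  -- A unit `u ∈ A` gives `S u ⊆ A ⊆ R`, so `S` is equivalent to `R`.
  obtain ⟨u, hu⟩ := exists_isUnit_mem hR.1 hA hne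
  have hSR : S = R := hR.2 S (hR.1.of_le hRS)
    ⟨⟨1, 1, fun x hx => by simpa using hRS hx⟩, ⟨1, u, fun x hx => by
      rw [Units.val_one, one_mul]; exact hle (hx u hu)⟩⟩ hRS
  rw [← hSR]
  exact hq

/-- The right multiplier ring of a nonzero ideal of a maximal order is the order itself. -/
theorem IsMaximalOrder.mem_of_mul_right (hR : IsMaximalOrder R) {A : AddSubgroup Q}
    (hA : IsBimodule R A) (hle : A ≤ R.toAddSubgroup) (hne : A ≠ ⊥) {q : Q}
    (hq : ∀ x ∈ A, x * q ∈ A) : q ∈ R := by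
  let S : Subring Q :=
    { carrier := {q | ∀ x ∈ A, x * q ∈ A}
      mul_mem' := fun {p q} hp hq x hx => by rw [← mul_assoc]; exact hq _ (hp x hx)
      one_mem' := fun x hx => by rwa [mul_one]
      add_mem' := fun {p q} hp hq x hx => by rw [mul_add]; exact A.add_mem (hp x hx) (hq x hx)
      zero_mem' := fun x _ => by rw [mul_zero]; exact A.zero_mem
      neg_mem' := fun {q} hq x hx => by rw [mul_neg]; exact A.neg_mem (hq x hx) }
  have hRS : R ≤ S := fun r hr x hx => hA.mul_right x hx r hr
  obtain ⟨u, hu⟩ := exists_isUnit_mem hR.1 hA hne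
  have hSR : S = R := hR.2 S (hR.1.of_le hRS)
    ⟨⟨1, 1, fun x hx => by simpa using hRS hx⟩, ⟨u, 1, fun x hx => by
      rw [Units.val_one, mul_one]; exact hle (hx u hu)⟩⟩ hRS
  rw [← hSR]
  exact hq

/-- Left and right inverses of nonzero ideals of a maximal order agree. -/
theorem IsMaximalOrder.leftInv_eq_rightInv (hR : IsMaximalOrder R) {A : AddSubgroup Q}
    (hA : IsBimodule R A) (hle : A ≤ R.toAddSubgroup) (hne : A ≠ ⊥) :
    leftInv R A = rightInv R A := by
  ext q
  constructor
  · intro hq a ha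
    -- `(a q) x = a (q x) ∈ A`, so `a q` is a left multiplier of `A`.
    refine hR.mem_of_mul_left hA hle hne fun x hx => ?_
    rw [mul_assoc]
    exact hA.mul_right a ha _ (hq x hx)
  · intro hq a ha
    refine hR.mem_of_mul_right hA hle hne fun x hx => ?_
    rw [← mul_assoc]
    exact hA.mul_left _ (hq x hx) a ha

/-- The left multiplier ring of the inverse of an ideal of a maximal order. -/
theorem IsMaximalOrder.mem_of_mul_left_leftInv (hR : IsMaximalOrder R) {A : AddSubgroup Q}
    (hA : IsBimodule R A) (hle : A ≤ R.toAddSubgroup) (hne : A ≠ ⊥) {q : Q}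
    (hq : ∀ b ∈ leftInv R A, q * b ∈ leftInv R A) : q ∈ R := by
  -- A left multiplier of `A⁻¹` is one of the nonzero ideal `A⁻¹ A` of `R`.
  refine hR.mem_of_mul_left (hA.leftInv.addProd hA) ?_ ?_ (q := q) ?_
  · refine (AddSubgroup.closure_le _).mpr ?_
    rintro _ ⟨b, hb, x, hx, rfl⟩
    exact hb x hx
  · refine fun h => hne (le_bot_iff.mp fun x hx => ?_)
    rw [← h, ← one_mul x]
    exact mul_mem_addProd (one_mem_leftInv hle) hx
  · intro x hx
    have h : addProd (leftInv R A : Set Q) (A : Set Q) ≤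
        (addProd (leftInv R A : Set Q) (A : Set Q)).comap (AddMonoidHom.mulLeft q) := by
      refine (AddSubgroup.closure_le _).mpr ?_
      rintro _ ⟨b, hb, y, hy, rfl⟩
      exact AddSubgroup.subset_closure ⟨q * b, hq b hb, y, hy, mul_assoc q b y⟩
    exact h hx

/-- The right multiplier ring of the inverse of an ideal of a maximal order. -/
theorem IsMaximalOrder.mem_of_mul_right_leftInv (hR : IsMaximalOrder R) {A : AddSubgroup Q}
    (hA : IsBimodule R A) (hle : A ≤ R.toAddSubgroup) (hne : A ≠ ⊥) {q : Q}
    (hq : ∀ b ∈ leftInv R A, b * q ∈ leftInv R A) : q ∈ R := by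
  refine hR.mem_of_mul_right (hA.addProd hA.leftInv) ?_ ?_ (q := q) ?_
  · refine (AddSubgroup.closure_le _).mpr ?_
    rintro _ ⟨x, hx, b, hb, rfl⟩
    rw [hR.leftInv_eq_rightInv hA hle hne] at hb
    exact hb x hx
  · refine fun h => hne (le_bot_iff.mp fun x hx => ?_)
    rw [← h, ← mul_one x]
    exact mul_mem_addProd hx (one_mem_leftInv hle)
  · intro x hx
    have h : addProd (A : Set Q) (leftInv R A : Set Q) ≤
        (addProd (A : Set Q) (leftInv R A : Set Q)).comap (AddMonoidHom.mulRight q) := by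
      refine (AddSubgroup.closure_le _).mpr ?_
      rintro _ ⟨y, hy, b, hb, rfl⟩
      exact AddSubgroup.subset_closure ⟨y, hy, b * q, hq b hb, (mul_assoc y b q).symm⟩
    exact h hx

/-- The divisorial closure can be computed on either side. -/
theorem IsMaximalOrder.mem_divClosure_iff (hR : IsMaximalOrder R) {A : AddSubgroup Q}
    (hA : IsBimodule R A) (hle : A ≤ R.toAddSubgroup) (hne : A ≠ ⊥) {x : Q} :
    x ∈ divClosure R A ↔ ∀ b ∈ leftInv R A, x * b ∈ R := by
  constructor
  · intro hx b hb
    refine hR.mem_of_mul_right_leftInv hA hle hne fun b' hb' => ?_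
    rw [← mul_assoc]
    exact hA.leftInv.mul_left _ (hx b' hb') b hb
  · intro hx b hb
    refine hR.mem_of_mul_left_leftInv hA hle hne fun b' hb' => ?_
    rw [mul_assoc]
    exact hA.leftInv.mul_right b hb _ (hx b' hb')

/-- A divisorial ideal `A` inside a maximal divisorial ideal `P` can be strictly enlarged to a
divisorial ideal `A'` with `P A' ⊆ A`. -/
theorem IsMaximalOrder.exists_isDivisorial_gt (hR : IsMaximalOrder R) {A P : AddSubgroup Q}
    (hA : IsDivisorial R A) (hP : IsMaximalDivisorial R P) (hAP : A ≤ P) :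
    ∃ A', IsDivisorial R A' ∧ A < A' ∧ ∀ p ∈ P, ∀ x ∈ A', p * x ∈ A := by
  have hPb := hP.divisorial.bimodule
  have hAb := hA.bimodule
  -- The enlargement is the divisorial closure of `P⁻¹ A`. It is strict because `P⁻¹ A ⊆ A` would
  -- force `P⁻¹ ⊆ R`.
  let X := addProd (leftInv R P : Set Q) (A : Set Q)
  have hXle : X ≤ R.toAddSubgroup := by
    refine (AddSubgroup.closure_le _).mpr ?_
    rintro _ ⟨b, hb, x, hx, rfl⟩
    exact hb x (hAP hx)
  have hAX : A ≤ X := fun x hx => by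
    rw [← one_mul x]
    exact mul_mem_addProd (one_mem_leftInv hP.divisorial.le) hx
  have hX : IsBimodule R X := hPb.leftInv.addProd hAb
  have hXne : X ≠ ⊥ := fun h => hA.ne_bot (le_bot_iff.mp (h ▸ hAX))
  refine ⟨divClosure R X, isDivisorial_divClosure hX hXle hXne,
    lt_of_le_not_ge (hAX.trans (le_divClosure X)) fun h => ?_, fun p hp x hx => ?_⟩
  · obtain ⟨q, hq, hqR⟩ := hP.divisorial.exists_leftInv_notMem hP.one_notMem
    exact hqR (hR.mem_of_mul_left hAb hA.le hA.ne_bot fun x hx =>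
      h (le_divClosure X (mul_mem_addProd hq hx)))
  -- For `b ∈ A⁻¹`, `b p (P⁻¹ A) ⊆ b A ⊆ R`, so `b p` also carries the closure of `P⁻¹ A` into `R`.
  · refine hA.closure_le fun b hb => ?_
    rw [← mul_assoc]
    refine hx _ fun y hy => ?_
    have hle : X ≤ R.toAddSubgroup.comap (AddMonoidHom.mulLeft (b * p)) := by
      refine (AddSubgroup.closure_le _).mpr ?_
      rintro _ ⟨c, hc, a, ha, rfl⟩
      have hpc : p * c ∈ R := by
        rw [SetLike.mem_coe,
          hR.leftInv_eq_rightInv hPb hP.divisorial.le hP.divisorial.ne_bot] at hc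
        exact hc p hp
      have h1 := hb _ (hAb.mul_left _ hpc a ha)
      have h2 : b * p * (c * a) = b * (p * c * a) := by simp only [mul_assoc]
      change b * p * (c * a) ∈ R
      rwa [h2]
    exact hle hy

end MaximalOrder

/-! ### The torsion theory `τ` on left ideals -/

section TauTopology

variable {Q : Type*} [Ring Q] {R : Subring Q}

theorem mem_leftResidual {A : Type*} [Ring A] {I : Ideal A} {r x : A} :
    x ∈ leftResidual I r ↔ x * r ∈ I := Iff.rfl

theorem leftResidual_leftResidual {A : Type*} [Ring A] (I : Ideal A) (r s : A) :
    leftResidual (leftResidual I r) s = leftResidual I (s * r) := by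
  ext x
  simp [mem_leftResidual, mul_assoc]

theorem isTauDenseLeft_iff {F : Ideal R} :
    IsTauDenseLeft R F ↔ ∀ r : R, ∀ q : Q, (∀ x : R, x * r ∈ F → (x : Q) * q ∈ R) → q ∈ R := by
  refine ⟨fun h r q hq => ?_, fun h r => Set.Subset.antisymm (fun q hq => h r q hq)
    fun q hq x _ => R.mul_mem x.2 hq⟩
  have : q ∈ {q : Q | ∀ x ∈ leftResidual F r, (x : Q) * q ∈ R} := hq
  rw [h r] at this
  exact this

theorem IsTauDenseLeft.mem {F : Ideal R} (hF : IsTauDenseLeft R F) {q : Q}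
    (hq : ∀ x ∈ F, (x : Q) * q ∈ R) : q ∈ R :=
  isTauDenseLeft_iff.mp hF 1 q fun x hx => hq x (by simpa using hx)

theorem IsTauDenseLeft.leftResidual {F : Ideal R} (hF : IsTauDenseLeft R F) (r : R) :
    IsTauDenseLeft R (leftResidual F r) := by
  intro s
  rw [leftResidual_leftResidual]
  exact hF _

theorem IsTauDenseLeft.mono {F G : Ideal R} (hF : IsTauDenseLeft R F) (h : F ≤ G) :
    IsTauDenseLeft R G :=
  isTauDenseLeft_iff.mpr fun r q hq =>
    isTauDenseLeft_iff.mp hF r q fun x hx => hq x (h hx)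

/-- This is the transitivity axiom of a Gabriel topology: density of the residuals puts `x q` into
`R` for all `x` with `x r ∈ J`, and density of `J` then puts `q` into `R`. -/
theorem IsTauDenseLeft.of_leftResidual {I J : Ideal R} (hJ : IsTauDenseLeft R J)
    (h : ∀ x ∈ J, IsTauDenseLeft R (BoundedKrull.leftResidual I x)) : IsTauDenseLeft R I := by
  refine isTauDenseLeft_iff.mpr fun r q hq => isTauDenseLeft_iff.mp hJ r q fun x hx => ?_
  refine (h _ hx).mem fun y hy => ?_
  have := hq (y * x) (by rw [mul_assoc]; exact hy)
  rw [← mul_assoc]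
  exact this

theorem IsTauDenseLeft.inf {F G : Ideal R} (hF : IsTauDenseLeft R F) (hG : IsTauDenseLeft R G) :
    IsTauDenseLeft R (F ⊓ G) :=
  hF.of_leftResidual fun x hx =>
    (hG.leftResidual x).mono fun y hy => ⟨F.mul_mem_left y hx, hy⟩

theorem isTauDenseLeft_top : IsTauDenseLeft R (⊤ : Ideal R) :=
  isTauDenseLeft_iff.mpr fun _ q hq => by simpa using hq 1 trivial

theorem IsTauClosedLeft.inf {I J : Ideal R} (hI : IsTauClosedLeft R I) (hJ : IsTauClosedLeft R J) :
    IsTauClosedLeft R (I ⊓ J) := fun r hr =>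
  ⟨hI r (hr.mono fun _ hx => hx.1), hJ r (hr.mono fun _ hx => hx.2)⟩

theorem IsTauClosedLeft.leftResidual {I : Ideal R} (hI : IsTauClosedLeft R I) (r : R) :
    IsTauClosedLeft R (leftResidual I r) := fun s hs => by
  rw [leftResidual_leftResidual] at hs
  exact hI _ hs

theorem isTauClosedLeft_top : IsTauClosedLeft R (⊤ : Ideal R) := fun _ _ => trivial

/-- The `τ`-closure of a left ideal. -/
def tauClosure (R : Subring Q) (I : Ideal R) : Ideal R where
  carrier := {r | IsTauDenseLeft R (leftResidual I r)}
  add_mem' {a b} ha hb := (IsTauDenseLeft.inf ha hb).mono fun x hx => by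
    rw [mem_leftResidual, mul_add]; exact I.add_mem hx.1 hx.2
  zero_mem' := isTauDenseLeft_top.mono fun x _ => by simp [mem_leftResidual]
  smul_mem' s a ha := by
    have := IsTauDenseLeft.leftResidual ha s
    rwa [leftResidual_leftResidual] at this

theorem mem_tauClosure {I : Ideal R} {r : R} :
    r ∈ tauClosure R I ↔ IsTauDenseLeft R (leftResidual I r) := Iff.rfl

theorem le_tauClosure (I : Ideal R) : I ≤ tauClosure R I := fun _ hr =>
  isTauDenseLeft_top.mono fun x _ => I.mul_mem_left x hr

theorem isTauClosedLeft_tauClosure (I : Ideal R) : IsTauClosedLeft R (tauClosure R I) :=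
  fun r hr => IsTauDenseLeft.of_leftResidual hr fun x hx => by
    rw [leftResidual_leftResidual]; exact hx

theorem tauClosure_mono {I J : Ideal R} (h : I ≤ J) : tauClosure R I ≤ tauClosure R J :=
  fun _ hr => IsTauDenseLeft.mono hr fun _ hx => h hx

theorem IsTauClosedLeft.tauClosure_le {I J : Ideal R} (hJ : IsTauClosedLeft R J) (h : I ≤ J) :
    tauClosure R I ≤ J := fun r hr => hJ r (IsTauDenseLeft.mono hr fun _ hx => h hx)

/-- The left ideal generated by a regular element is `τ`-closed. -/
theorem isTauClosedLeft_span_singleton (hR : IsOrder R) (c : R) (hc : c ∈ nonZeroDivisors R) :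
    IsTauClosedLeft R (Ideal.span {c}) := by
  intro r hr
  obtain ⟨w, hw⟩ := hR.isUnit_of_regular c hc
  have h : (r : Q) * (↑w⁻¹ : Q) ∈ R := by
    refine hr.mem fun x hx => ?_
    obtain ⟨s, hs⟩ := Ideal.mem_span_singleton'.mp (mem_leftResidual.mp hx)
    have hs' : (s : Q) * w = x * r := by rw [hw]; exact congrArg Subtype.val hs
    rw [← mul_assoc, ← hs', mul_assoc, Units.mul_inv, mul_one]
    exact s.2
  refine Ideal.mem_span_singleton'.mpr ⟨⟨_, h⟩, Subtype.ext ?_⟩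
  change (r : Q) * (↑w⁻¹ : Q) * c = r
  rw [← hw, mul_assoc, Units.inv_mul, mul_one]

end TauTopology

/-! ### Chains of `τ`-closed left ideals -/

section Intervals

variable {Q : Type*} [Ring Q] {R : Subring Q}

/-- The `τ`-closed left ideals between `X` and `Y` admit a strictly increasing `ℕ`-valued
function. -/
def HasFiniteRank (R : Subring Q) (X Y : Ideal R) : Prop :=
  ∃ f : Ideal R → ℕ, ∀ Z W, IsTauClosedLeft R Z → IsTauClosedLeft R W → X ≤ Z → Z < W → W ≤ Y →
    f Z < f W

theorem hasFiniteRank_self (X : Ideal R) : HasFiniteRank R X X :=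
  ⟨fun _ => 0, fun _ _ _ _ h1 h2 h3 => absurd (h1.trans_lt h2) h3.not_gt⟩

/-- The modular law for `τ`-closed left ideals. -/
theorem le_of_inf_le_of_le_tauClosure {Z W K : Ideal R} (hZ : IsTauClosedLeft R Z) (hZW : Z ≤ W)
    (h1 : W ⊓ K ≤ Z) (h2 : W ≤ tauClosure R (Z ⊔ K)) : W ≤ Z := by
  intro w hw
  refine hZ w ((mem_tauClosure.mp (h2 hw)).mono fun x hx => ?_)
  obtain ⟨z, hz, k, hk, hzk⟩ := Submodule.mem_sup.mp (mem_leftResidual.mp hx)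
  have hkW : k ∈ W := by
    rw [← add_sub_cancel_left z k, hzk]
    exact W.sub_mem (W.mul_mem_left x hw) (hZW hz)
  rw [mem_leftResidual, ← hzk]
  exact Z.add_mem hz (h1 ⟨hkW, hk⟩)

/-- By the modular law, `Z < W` cannot agree both in the meet with `K` and in the closed join with
`K`, so the sum of the two rank functions increases. -/
theorem HasFiniteRank.trans {X K Y : Ideal R} (hK : IsTauClosedLeft R K)
    (hY : IsTauClosedLeft R Y) (hXK : X ≤ K) (hKY : K ≤ Y)
    (h1 : HasFiniteRank R X K) (h2 : HasFiniteRank R K Y) : HasFiniteRank R X Y := by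
  obtain ⟨f, hf⟩ := h1
  obtain ⟨g, hg⟩ := h2
  refine ⟨fun Z => f (Z ⊓ K) + g (tauClosure R (Z ⊔ K)), fun Z W hZ hW hXZ hZW hWY => ?_⟩
  have a1 : Z ⊓ K ≤ W ⊓ K := inf_le_inf_right K hZW.le
  have a2 : tauClosure R (Z ⊔ K) ≤ tauClosure R (W ⊔ K) :=
    tauClosure_mono (sup_le_sup_right hZW.le K)
  have b1 : Z ⊓ K < W ⊓ K → f (Z ⊓ K) < f (W ⊓ K) := fun h =>
    hf _ _ (hZ.inf hK) (hW.inf hK) (le_inf hXZ hXK) h inf_le_right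
  have b2 : tauClosure R (Z ⊔ K) < tauClosure R (W ⊔ K) →
      g (tauClosure R (Z ⊔ K)) < g (tauClosure R (W ⊔ K)) := fun h =>
    hg _ _ (isTauClosedLeft_tauClosure _) (isTauClosedLeft_tauClosure _)
      (le_sup_right.trans (le_tauClosure _)) h (hY.tauClosure_le (sup_le hWY hKY))
  change f (Z ⊓ K) + g (tauClosure R (Z ⊔ K)) < f (W ⊓ K) + g (tauClosure R (W ⊔ K))
  rcases eq_or_lt_of_le a1 with e1 | l1
  · rcases eq_or_lt_of_le a2 with e2 | l2
    · refine absurd (le_of_inf_le_of_le_tauClosure (K := K) hZ hZW.le ?_ ?_) hZW.not_ge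
      · exact e1.ge.trans inf_le_left
      · exact (le_sup_left.trans (le_tauClosure _)).trans e2.ge
    · rw [e1]; exact Nat.add_lt_add_left (b2 l2) _
  · rcases eq_or_lt_of_le a2 with e2 | l2
    · rw [e2]; exact Nat.add_lt_add_right (b1 l1) _
    · exact Nat.add_lt_add (b1 l1) (b2 l2)

/-- `M / X` is an essential submodule of `Y / X`, where `X` is contained in `M` and `Y`. -/
def IsEssentialBetween {A : Type*} [Ring A] (X M Y : Ideal A) : Prop :=
  ∀ C : Ideal A, X ≤ C → C ≤ Y → C ⊓ M ≤ X → C ≤ X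

/-- Right multiplication by `y` carries a test ideal `J` to `J y`, and essentiality is applied to `X
+ J y`. -/
theorem IsEssentialBetween.leftResidual {A : Type*} [Ring A] {P X M Y : Ideal A}
    (h : IsEssentialBetween X M Y) (hXY : X ≤ Y) (hXM : X ≤ M) {y : A} (hy : y ∈ Y)
    (hP : ∀ p ∈ P, p * y ∈ X) : IsEssentialBetween P (leftResidual M y) ⊤ := by
  intro J _ _ hJM
  let D : Ideal A := Submodule.map (LinearMap.toSpanSingleton A A y) J
  have hD : ∀ d, d ∈ D ↔ ∃ j ∈ J, j * y = d := fun d => Iff.rfl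
  have key : X ⊔ D ≤ X := by
    refine h (X ⊔ D) le_sup_left (sup_le hXY ?_) ?_
    · rintro d hd
      obtain ⟨j, -, rfl⟩ := (hD d).mp hd
      exact Y.mul_mem_left j hy
    · rintro c ⟨hc, hcM⟩
      obtain ⟨x, hx, d, hd, rfl⟩ := Submodule.mem_sup.mp hc
      obtain ⟨j, hj, rfl⟩ := (hD d).mp hd
      have : j * y ∈ M := by
        have := M.sub_mem hcM (hXM hx)
        rwa [add_sub_cancel_left] at this
      exact X.add_mem hx (hP j (hJM ⟨hj, this⟩))
  intro j hj
  exact hJM ⟨hj, hXM (key (le_sup_right (a := X) ((hD _).mpr ⟨j, hj, rfl⟩)))⟩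

/-- Suppose that left ideals that are essential over `P` are `τ`-dense. If `P Y ⊆ X`, then there
are only chains of bounded length of `τ`-closed left ideals between `X` and `Y`. -/
theorem hasFiniteRank_of_mul_le (hacc : WellFoundedGT {I : Ideal R // IsTauClosedLeft R I})
    {P : Ideal R}
    (hP : ∀ K : Ideal R, P ≤ K → IsEssentialBetween P K ⊤ → IsTauDenseLeft R K)
    {Y : Ideal R} (hY : IsTauClosedLeft R Y) (X : {I : Ideal R // IsTauClosedLeft R I})
    (hXY : X.1 ≤ Y) (hPY : ∀ p ∈ P, ∀ y ∈ Y, p * y ∈ X.1) : HasFiniteRank R X Y := by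
  classical
  induction X using hacc.induction with
  | ind X ih =>
  obtain ⟨X, hX⟩ := X
  simp only at hXY hPY ih ⊢
  rcases eq_or_lt_of_le hXY with rfl | hlt
  · exact hasFiniteRank_self X
  obtain ⟨⟨M, hM⟩, ⟨hXM, hMY⟩, hmax⟩ := hacc.wf.has_min
    {M : {I : Ideal R // IsTauClosedLeft R I} | X ≤ M.1 ∧ M.1 < Y} ⟨⟨X, hX⟩, le_rfl, hlt⟩
  simp only at hXM hMY
  have hmax' : ∀ M', IsTauClosedLeft R M' → M < M' → M' ≤ Y → M' = Y := by
    intro M' hM' hlt' hle'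
    by_contra hne
    exact hmax ⟨M', hM'⟩ ⟨hXM.trans hlt'.le, lt_of_le_of_ne hle' hne⟩ hlt'
  -- `M / X` is not essential in `Y / X`: otherwise the residual of `M` at each `y ∈ Y` would be
  -- essential over `P`, hence dense, and closedness would give `Y ≤ M`.
  obtain ⟨C, hXC, hCY, hCM, hCX⟩ : ∃ C : Ideal R, X ≤ C ∧ C ≤ Y ∧ C ⊓ M ≤ X ∧ ¬ C ≤ X := by
    by_contra! hess
    refine hMY.not_ge fun y hy => hM y (hP _ (fun p hp => hXM (hPY p hp y hy)) ?_)
    exact IsEssentialBetween.leftResidual hess hXY hXM hy fun p hp => hPY p hp y hy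
  have hNc := isTauClosedLeft_tauClosure C
  have hCN := le_tauClosure C
  have hNY := hY.tauClosure_le hCY
  set N := tauClosure R C with hN
  have hNM : N ⊓ M ≤ X := by
    rintro y ⟨hyN, hyM⟩
    exact hX y ((mem_tauClosure.mp hyN).mono fun r hr => hCM ⟨hr, M.mul_mem_left r hyM⟩)
  have hXN : X < N := lt_of_le_not_ge (hXC.trans hCN) fun h => hCX (hCN.trans h)
  -- `N` covers `X`: a closed `Z` in between, joined with the maximal `M`, closes up to `Y`, and the
  -- modular law gives `Z = N`. So this step has rank one, and induction continues from `N`.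
  have hcover : ∀ Z, IsTauClosedLeft R Z → X < Z → Z ≤ N → Z = N := by
    intro Z hZ hXZ hZN
    refine le_antisymm hZN (le_of_inf_le_of_le_tauClosure hZ hZN (hNM.trans hXZ.le) ?_)
    have hlt' : M < tauClosure R (Z ⊔ M) := by
      refine lt_of_le_not_ge (le_sup_right.trans (le_tauClosure _)) fun h => hXZ.not_ge ?_
      exact (le_inf hZN ((le_sup_left.trans (le_tauClosure _)).trans h)).trans hNM
    rw [hmax' _ (isTauClosedLeft_tauClosure _) hlt'
      (hY.tauClosure_le (sup_le (hZN.trans hNY) hMY.le))]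
    exact hNY
  have h1 : HasFiniteRank R X N := by
    refine ⟨fun Z => if Z = X then 0 else 1, fun Z W hZ hW hXZ hZW hWN => ?_⟩
    have hWX : W ≠ X := (hXZ.trans_lt hZW).ne'
    have hZX : Z = X := by
      by_contra hne
      have e1 := hcover Z hZ (lt_of_le_of_ne hXZ (Ne.symm hne)) (hZW.le.trans hWN)
      exact hZW.not_ge (e1 ▸ hWN)
    simp [hZX, hWX]
  exact h1.trans hNc hY hXN.le hNY
    (ih ⟨N, hNc⟩ hXN hNY fun p hp y hy => hXN.le (hPY p hp y hy))

end Intervals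

/-! ### Krull orders in the sense of Chamarie -/

section Chamarie

variable {Q : Type*} [Ring Q] {R : Subring Q}

/-- The left ideal of `R` given by a bimodule in `Q`. -/
def toIdeal {A : AddSubgroup Q} (hA : IsBimodule R A) : Ideal R where
  carrier := {x | (x : Q) ∈ A}
  add_mem' hx hy := A.add_mem hx hy
  zero_mem' := A.zero_mem
  smul_mem' r x hx := hA.mul_left r r.2 x hx

/-- A factor ring by a semiprime ideal with the ascending chain condition on annihilators is
nonsingular. -/
theorem mem_of_isEssentialBetween_leftResidual {P : AddSubgroup Q} (hPb : IsBimodule R P)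
    (hacc : WellFoundedGT {I : Ideal R // IsTauClosedLeft R I})
    (hPc : IsTauClosedLeft R (toIdeal hPb))
    (hsp : ∀ z ∈ R, (∀ s ∈ R, z * s * z ∈ P) → z ∈ P) (z : R)
    (hz : IsEssentialBetween (toIdeal hPb) (leftResidual (toIdeal hPb) z) ⊤) :
    (z : Q) ∈ P := by
  by_contra hzP
  let Z : Set R := {z | IsEssentialBetween (toIdeal hPb) (leftResidual (toIdeal hPb) z) ⊤ ∧
    (z : Q) ∉ P}
  have hle : ∀ w : R, toIdeal hPb ≤ leftResidual (toIdeal hPb) w :=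
    fun w x hx => hPb.mul_right _ hx _ w.2
  -- Among the singular elements outside `P`, `w` has a maximal left annihilator modulo `P`. If `w s
  -- w ∉ P`, it is singular with the same annihilator.
  obtain ⟨_, ⟨w, ⟨hw, hwP⟩, rfl⟩, hmax⟩ := hacc.wf.has_min
    ((fun z : R => (⟨leftResidual (toIdeal hPb) z, hPc.leftResidual z⟩ :
      {I : Ideal R // IsTauClosedLeft R I})) '' Z) ⟨_, z, ⟨hz, hzP⟩, rfl⟩
  refine hwP (hsp w w.2 fun s hs => ?_)
  by_contra hcon
  let v : R := w * ⟨s, hs⟩ * w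
  have hwv : leftResidual (toIdeal hPb) w ≤ leftResidual (toIdeal hPb) v := by
    intro x hx
    have : x * v = x * w * (⟨s, hs⟩ * w) := by simp only [v, mul_assoc]
    rw [mem_leftResidual, this]
    exact hPb.mul_right _ hx _ (⟨s, hs⟩ * w : R).2
  have hv : v ∈ Z := by
    refine ⟨fun C h1 h2 h3 => hw C h1 h2 ((inf_le_inf_left C hwv).trans h3), hcon⟩
  have hsw : IsEssentialBetween (toIdeal hPb)
      (leftResidual (toIdeal hPb) ((⟨s, hs⟩ : R) * w)) ⊤ := by
    rw [← leftResidual_leftResidual]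
    exact hw.leftResidual le_top (hle w) trivial fun p hp => hPb.mul_right _ hp _ hs
  refine hmax _ ⟨v, hv, rfl⟩ (lt_of_le_not_ge hwv fun hvw => hwP ?_)
  -- Equality of the annihilators of `w` and `w s w` makes `Rw` meet that of `s w` only inside `P`,
  -- against essentiality.
  have key := hsw (toIdeal hPb ⊔ Ideal.span {w}) le_sup_left le_top ?_
  · exact key (Ideal.mem_sup_right (Ideal.mem_span_singleton_self w))
  · rintro c ⟨hc, hc'⟩
    obtain ⟨p, hp, d, hd, rfl⟩ := Submodule.mem_sup.mp hc
    obtain ⟨t, rfl⟩ := Ideal.mem_span_singleton'.mp hd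
    have h1 : t * w ∈ leftResidual (toIdeal hPb) ((⟨s, hs⟩ : R) * w) := by
      have := Ideal.sub_mem _ hc' (hle _ hp)
      rwa [add_sub_cancel_left] at this
    have h2 : t ∈ leftResidual (toIdeal hPb) v := by
      have e : t * v = t * w * (⟨s, hs⟩ * w) := by simp only [v, mul_assoc]
      rw [mem_leftResidual, e]
      exact h1
    exact Ideal.add_mem _ hp (hvw h2)

variable [IsSimpleRing Q] [IsArtinianRing Q]

/-- Divisorial ideals are `τ`-closed. -/
theorem IsMaximalOrder.isTauClosedLeft_of_isDivisorial (hR : IsMaximalOrder R)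
    {A : AddSubgroup Q} (hA : IsDivisorial R A) : IsTauClosedLeft R (toIdeal hA.bimodule) := by
  intro r hr
  refine hA.closure_le ((hR.mem_divClosure_iff hA.bimodule hA.le hA.ne_bot).mpr fun b hb => ?_)
  refine hr.mem fun x hx => ?_
  rw [hR.leftInv_eq_rightInv hA.bimodule hA.le hA.ne_bot] at hb
  rw [← mul_assoc]
  exact hb _ hx

/-- Left ideals that are essential over a maximal divisorial ideal are `τ`-dense. -/
theorem IsMaximalOrder.isTauDenseLeft_of_isEssentialBetween (hR : IsMaximalOrder R)
    (hacc : WellFoundedGT {I : Ideal R // IsTauClosedLeft R I})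
    {P : AddSubgroup Q} (hP : IsMaximalDivisorial R P) (K : Ideal R)
    (hPK : toIdeal hP.divisorial.bimodule ≤ K)
    (hK : IsEssentialBetween (toIdeal hP.divisorial.bimodule) K ⊤) : IsTauDenseLeft R K := by
  have hPd := hP.divisorial
  have hPb := hPd.bimodule
  have hPc := hR.isTauClosedLeft_of_isDivisorial hPd
  refine isTauDenseLeft_iff.mpr fun r q hq => ?_
  have hPr : ∀ p ∈ toIdeal hPb, p * r ∈ toIdeal hPb := fun p hp => hPb.mul_right _ hp _ r.2
  have hKr := hK.leftResidual le_top hPK (y := r) trivial hPr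
  have hqP : q ∈ rightInv R P := fun x hx =>
    hq ⟨x, hPd.le hx⟩ (hPK (hPr ⟨x, hPd.le hx⟩ hx))
  -- It suffices that `q P ⊆ P`. Each `q p` lies in `R` and is annihilated modulo `P` by the
  -- essential residual of `K`, so nonsingularity applies.
  refine hR.mem_of_mul_left hPb hPd.le hPd.ne_bot fun p hp => ?_
  rw [← hR.leftInv_eq_rightInv hPb hPd.le hPd.ne_bot] at hqP
  refine mem_of_isEssentialBetween_leftResidual hPb hacc hPc
    (fun z hzR hz => hP.semiprime hzR hz) ⟨q * p, hqP p hp⟩ ?_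
  refine fun C h1 h2 h3 => hKr C h1 h2 ((inf_le_inf_left C fun x hx => ?_).trans h3)
  change (x : Q) * (q * p) ∈ P
  rw [← mul_assoc]
  exact hPb.mul_left _ (hq x hx) p hp

/-- Divisorial ideals are `τ`-closed as left ideals, so they inherit the ascending chain condition.
-/
theorem IsMaximalOrder.exists_isMaximalDivisorial_ge (hR : IsMaximalOrder R)
    (hacc : WellFoundedGT {I : Ideal R // IsTauClosedLeft R I}) {A : AddSubgroup Q}
    (hA : IsDivisorial R A) (h1 : (1 : Q) ∉ A) : ∃ P, IsMaximalDivisorial R P ∧ A ≤ P := by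
  obtain ⟨_, ⟨P, hP, hAP, h1P, rfl⟩, hmax⟩ := hacc.wf.has_min
    {I | ∃ (P : AddSubgroup Q) (hP : IsDivisorial R P), A ≤ P ∧ (1 : Q) ∉ P ∧
      I = ⟨toIdeal hP.bimodule, hR.isTauClosedLeft_of_isDivisorial hP⟩} ⟨_, A, hA, le_rfl, h1, rfl⟩
  refine ⟨P, ⟨hP, h1P, fun B hB hPB h1B => ?_⟩, hAP⟩
  by_contra hne
  refine hmax _ ⟨B, hB, hAP.trans hPB, h1B, rfl⟩ (lt_of_le_not_ge (fun x hx => hPB hx) ?_)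
  exact fun h => hne fun x hx => h (x := (⟨x, hB.le hx⟩ : R)) hx

/-- Chains of `τ`-closed left ideals containing a fixed divisorial ideal have bounded length. -/
theorem IsMaximalOrder.hasFiniteRank_toIdeal_top (hR : IsMaximalOrder R)
    (hacc : WellFoundedGT {I : Ideal R // IsTauClosedLeft R I}) {A : AddSubgroup Q}
    (hA : IsDivisorial R A) : HasFiniteRank R (toIdeal hA.bimodule) ⊤ := by
  have key : ∀ I : {I : Ideal R // IsTauClosedLeft R I}, ∀ (A : AddSubgroup Q)
      (hA : IsDivisorial R A), I.1 = toIdeal hA.bimodule → HasFiniteRank R I ⊤ := by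
    intro I
    induction I using hacc.induction with
    | ind I ih =>
    intro A hA hI
    by_cases h1 : (1 : Q) ∈ A
    · have : I.1 = ⊤ := by
        rw [hI, Ideal.eq_top_iff_one]
        exact h1
      rw [this]
      exact hasFiniteRank_self ⊤
    obtain ⟨P, hP, hAP⟩ := hR.exists_isMaximalDivisorial_ge hacc hA h1
    obtain ⟨A', hA', hlt, hmul⟩ := hR.exists_isDivisorial_gt hA hP hAP
    have hA'c := hR.isTauClosedLeft_of_isDivisorial hA'
    have hlt' : I.1 < toIdeal hA'.bimodule := by
      rw [hI]
      refine lt_of_le_not_ge (fun x hx => hlt.le hx) fun h => hlt.not_ge fun x hx => ?_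
      exact h (x := (⟨x, hA'.le hx⟩ : R)) hx
    refine HasFiniteRank.trans hA'c isTauClosedLeft_top hlt'.le le_top ?_
      (ih ⟨_, hA'c⟩ hlt' A' hA' rfl)
    refine hasFiniteRank_of_mul_le hacc
      (hR.isTauDenseLeft_of_isEssentialBetween hacc hP) hA'c I hlt'.le fun p hp y hy => ?_
    rw [hI]
    exact hmul p hp y hy
  exact key ⟨_, hR.isTauClosedLeft_of_isDivisorial hA⟩ A hA rfl

theorem isBFRing_of_isBoundedKrullChamarie (h : IsBoundedKrullChamarie R) : IsBFRing R := by
  obtain ⟨⟨hmax, -, hacc⟩, hb⟩ := h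
  have hR := hmax.1
  refine isBFMonoid_of_potential fun a => ?_
  obtain ⟨A₀, hA₀, hA₀a⟩ := exists_ideal_le_span_singleton hR hb a a.2
  let A : AddSubgroup Q := A₀.asIdeal.toAddSubgroup.map R.subtype.toAddMonoidHom
  have hA : ∀ q, q ∈ A ↔ ∃ x ∈ A₀, (x : Q) = q := fun q => Iff.rfl
  have hAb : IsBimodule R A := by
    constructor
    · intro r hr q hq
      obtain ⟨x, hx, rfl⟩ := (hA q).mp hq
      exact (hA _).mpr ⟨⟨r, hr⟩ * x, A₀.mul_mem_left _ _ hx, rfl⟩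
    · intro q hq r hr
      obtain ⟨x, hx, rfl⟩ := (hA q).mp hq
      exact (hA _).mpr ⟨x * ⟨r, hr⟩, A₀.mul_mem_right _ _ hx, rfl⟩
  have hAle : A ≤ R.toAddSubgroup := by
    intro q hq
    obtain ⟨x, -, rfl⟩ := (hA q).mp hq
    exact x.2
  have hAne : A ≠ ⊥ := by
    refine fun h => hA₀ (le_bot_iff.mp fun x hx => ?_)
    have h1 : (x : Q) ∈ A := (hA _).mpr ⟨x, hx, rfl⟩
    rw [h, AddSubgroup.mem_bot] at h1
    rw [show x = 0 from Subtype.ext h1]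
    exact zero_mem _
  have hD := isDivisorial_divClosure hAb hAle hAne
  obtain ⟨f, hf⟩ := hmax.hasFiniteRank_toIdeal_top hacc hD
  -- `A ⊆ Ra` means `A a⁻¹ ⊆ R`, so `a⁻¹` lies in the inverse of `A`, and the closure multiplied by
  -- `a⁻¹` stays in `R`.
  have hDa : toIdeal hD.bimodule ≤ Ideal.span {(a : R)} := by
    intro x hx
    obtain ⟨w, hw⟩ := hR.isUnit_of_regular a a.2
    have hwA : (↑w⁻¹ : Q) ∈ leftInv R A := by
      rw [hmax.leftInv_eq_rightInv hAb hAle hAne]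
      intro q hq
      obtain ⟨y, hy, rfl⟩ := (hA q).mp hq
      obtain ⟨r, rfl⟩ := hA₀a y hy
      rw [Subring.coe_mul, ← hw, mul_assoc, Units.mul_inv, mul_one]
      exact r.2
    have h1 := (hmax.mem_divClosure_iff hAb hAle hAne).mp hx _ hwA
    refine Ideal.mem_span_singleton'.mpr ⟨⟨_, h1⟩, Subtype.ext ?_⟩
    change (x : Q) * (↑w⁻¹ : Q) * ((a : R) : Q) = x
    rw [← hw, mul_assoc, Units.inv_mul, mul_one]
  have hclosed : ∀ c : nonZeroDivisors R, IsTauClosedLeft R (Ideal.span {(c : R)}) :=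
    fun c => isTauClosedLeft_span_singleton hR c c.2
  -- `Rc` shrinks as `c` gains left factors, so the rank is counted downwards from `⊤`; truncated
  -- subtraction is harmless because `f (Rc) ≤ f ⊤`.
  refine ⟨fun c => f ⊤ - f (Ideal.span {(c : R)}), fun v u c hvuc hu => ?_⟩
  have h1 : Ideal.span {(a : R)} ≤ Ideal.span {((u * c : nonZeroDivisors R) : R)} := by
    rw [Ideal.span_singleton_le_iff_mem, Ideal.mem_span_singleton']
    exact ⟨v, congrArg Subtype.val hvuc⟩
  have h2 : Ideal.span {((u * c : nonZeroDivisors R) : R)} < Ideal.span {(c : R)} := by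
    refine lt_of_le_not_ge ?_ fun h => hu ?_
    · rw [Ideal.span_singleton_le_iff_mem, Ideal.mem_span_singleton']
      exact ⟨u, rfl⟩
    · rw [Ideal.span_singleton_le_iff_mem, Ideal.mem_span_singleton'] at h
      obtain ⟨t, ht⟩ := h
      refine isUnit_of_left_inv_mem hR u t t.2
        ((hR.isUnit_of_regular c c.2).mul_right_cancel ?_)
      rw [one_mul, mul_assoc]
      exact congrArg Subtype.val ht
  have h3 := hf _ _ (hclosed (u * c)) (hclosed c) (hDa.trans h1) h2 le_top
  have h4 : f (Ideal.span {(c : R)}) ≤ f ⊤ := by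
    rcases eq_or_lt_of_le (le_top (a := Ideal.span {(c : R)})) with e | l
    · rw [e]
    · exact (hf _ _ (hclosed c) isTauClosedLeft_top ((hDa.trans h1).trans h2.le) l le_rfl).le
  change f ⊤ - f (Ideal.span {(c : R)}) <
    f ⊤ - f (Ideal.span {((u * c : nonZeroDivisors R) : R)})
  omega

end Chamarie

end BoundedKrull

theorem mainTheorem11 {Q : Type*} [Ring Q] [IsSimpleRing Q] [IsArtinianRing Q]
    (R : Subring Q)
    (hR : BoundedKrull.IsBoundedKrullChamarie R ∨ BoundedKrull.IsBoundedKrullMarubayashi R) :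
    BoundedKrull.IsBFRing R :=
  hR.elim BoundedKrull.isBFRing_of_isBoundedKrullChamarie
    BoundedKrull.isBFRing_of_isBoundedKrullMarubayashi
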